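/- **Theorem (EDS to coarsening).** *Full problem.* Let $N\ge 1$ and, for each stage $i\in\{1,\dots,N\}$, let $z_i=(x_i,u_i)\in\mathbb{R}^{n_x}\times\mathbb{R}^{n_u}$, $n=n_x+n_u$, $m=4n_x+2n_w+2n_u$. Given real matrices $A_i\in\mathbb{R}^{n_x\times n_x}$, $B_i\in\mathbb{R}^{n_x\times n_u}$, $E_i\in\mathbb{R}^{n_w\times n_x}$, $F_i\in\mathbb{R}^{n_w\times n_u}$, let $$G_{i,i-1}=\begin{bmatrix}-A_{i-1}&-B_{i-1}\\ A_{i-1}&B_{i-1}\\0&0\\0&0\\0&0\\0&0\\0&0\\0&0\end{bmatrix},\qquad G_{i,i}=\begin{bmatrix}I&0\\-I&0\\E_i&F_i\\-E_i&-F_i\\I&0\\-I&0\\0&I\\0&-I\end{bmatrix}\in\mathbb{R}^{m\times n},$$ let $G\in\mathbb{R}^{mN\times nN}$ be the block matrix with these blocks and zero blocks elsewhere, and let $p\in\mathbb{R}^{nN}$. For $d=(d_1,\dots,d_N)\in\mathbb{R}^{mN}$ let $P(d)$ be the linear program $\min_z\ p^\top z$ subject to $Gz\ge d$ (componentwise).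 Let $\mathbb{D}$ be the set of $d$ for which $P(d)$ is feasible. *Constants.* A set $B$ of row indices is a basis if $G[B,:]$ is non-singular; it is optimal for $P(d)$ if the solution of $G[B,:]z=d[B]$ is an optimal solution of $P(d)$. Let $\mathbb{B}$ be the set of bases that are optimal for $P(d)$ for some $d\in\mathbb{D}$, and let $$\underline\sigma=\min_{B\in\mathbb{B}}\sigma_{\min}(G[B,:]),\quad \overline\sigma=\max_{B\in\mathbb{B}}\sigma_{\max}(G[B,:]),\quad \Gamma=\frac{\overline\sigma}{\underline\sigma^2},\quad \rho=\frac{\overline\sigma^2-\underline\sigma^2}{\overline\sigma^2+\underline\sigma^2}.$$ *Coarse problem.* Let $1=M_1<\dots<M_K\le N$, $M_{K+1}=N+1$, let $J_k=\{M_k,\dots,M_{k+1}-1\}$ and $L_k=|J_k|$. Let $T=\mathrm{diag}(T_1,\dots,T_K)$ and $U=\mathrm{diag}(U_1,\dots,U_K)$, where $T_k$ (resp. $U_k$) is $L_k^{-1/2}$ times the vertical stack of $L_k$ copies of the identity matrix of size $n$ (resp. $m$). For a prior guess $z^o\in\mathbb{R}^{nN}$, $\lambda^o\in\mathbb{R}^{mN}$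 let $\tilde G=U^\top GT$, $\tilde d=U^\top(d-Gz^o)$, $\tilde p=T^\top(p-G^\top\lambda^o)$. The coarse LP is $\min_{\tilde z}\ \tilde p^\top\tilde z$ subject to $\tilde G\tilde z\ge\tilde d$; a projected coarse solution is a vector $z'=z^o+T\tilde z^*$ with $\tilde z^*$ an optimal solution of the coarse LP. Let $S$ be the union of the blocks $J_k$ that consist of a single stage $i$ with $\lambda^o_i=0$, and let $$\Delta=\max\Big\{\max_{1\le j\le N}\|d_j-G_{j,j-1}z'_{j-1}-G_{j,j}z'_j\| : z'=z^o+T\tilde z,\ \tilde G\tilde z\ge\tilde d\Big\}$$ (with $G_{1,0}=0$, $z'_0=0$; all norms are Euclidean). *Claim.* Let $d\in\mathbb{D}$, let $z^o$ be feasible for $P(d)$, and let $\lambda^o$ and the coarse grid be arbitrary. Then the extrema defining $\underline\sigma$, $\overline\sigma$ and $\Delta$ are attained, and there exist an optimal solution $z^*=(z_1^*,\dots,z_N^*)$ of $P(d)$ and a projected coarse solution $z'=(z_1',\dots,z_N')$ such that for all $i\in\{1,\dots,N\}$ $$\|z_i^*-z_i'\|\le\sum_{j\in\{1,\dots,N\}\setminus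 S}\Gamma\,\Delta\,\rho^{(|i-j|-1)_+},\qquad (t)_+:=\max(0,t).$$ -/

import Mathlib

open Matrix

noncomputable section

namespace CoarseMPC

/-! ### Linear programs `min pᵀz  s.t.  G z ≥ d` -/

section LP

variable {ρ ι : Type*} [Fintype ι]

/-- `z` is feasible: `G z ≥ d` component-wise. -/
def IsFeasible (G : Matrix ρ ι ℝ) (d : ρ → ℝ) (z : ι → ℝ) : Prop :=
  ∀ r, d r ≤ (G *ᵥ z) r

/-- `z` is an optimal solution of `min pᵀz  s.t.  G z ≥ d`. -/
def IsSolution (G : Matrix ρ ι ℝ) (d : ρ → ℝ) (p : ι → ℝ) (z : ι → ℝ) : Prop :=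
  IsFeasible G d z ∧ ∀ y, IsFeasible G d y → p ⬝ᵥ z ≤ p ⬝ᵥ y

/-- The set of admissible data: those `d` for which the program is feasible. -/
def admissible (G : Matrix ρ ι ℝ) : Set (ρ → ℝ) :=
  {d | ∃ z, IsFeasible G d z}

/-- The row submatrix `G[B, :]`. -/
def rowSub (G : Matrix ρ ι ℝ) (B : Finset ρ) : Matrix B ι ℝ :=
  G.submatrix (fun b => (b : ρ)) id

/-- `B` is a basis: `G[B, :]` is non-singular, i.e. an invertible linear map
(in particular `B` has as many elements as `G` has columns). -/
def IsBasis (G : Matrix ρ ι ℝ) (B : Finset ρ) : Prop :=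
  Function.Bijective ((rowSub G B).mulVec)

/-- `z` is a basic solution for `B`: `G[B, :] z = d[B]`. -/
def IsBasicSolution (G : Matrix ρ ι ℝ) (d : ρ → ℝ) (B : Finset ρ) (z : ι → ℝ) : Prop :=
  rowSub G B *ᵥ z = fun b : B => d (b : ρ)

/-- `B` is an optimal basis for the data `d`: it is a basis and its basic solution is optimal. -/
def IsOptimalBasis (G : Matrix ρ ι ℝ) (d : ρ → ℝ) (p : ι → ℝ) (B : Finset ρ) : Prop :=
  IsBasis G B ∧ ∃ z, IsBasicSolution G d B z ∧ IsSolution G d p z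

/-- All bases that are optimal for some admissible data. -/
def optimalBases (G : Matrix ρ ι ℝ) (p : ι → ℝ) : Set (Finset ρ) :=
  {B | ∃ d ∈ admissible G, IsOptimalBasis G d p B}

variable [DecidableEq ι]

/-- Largest singular value of `G[B, :]`. -/
def sigmaMaxB (G : Matrix ρ ι ℝ) (B : Finset ρ) : ℝ :=
  (Matrix.toEuclideanLin (rowSub G B)).singularValues 0

/-- Smallest singular value of `G[B, :]` (a square matrix when `B` is a basis). The singular values
are listed in decreasing order from index `0`, one for each column. -/
def sigmaMinB (G : Matrix ρ ι ℝ) (B : Finset ρ) : ℝ :=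
  (Matrix.toEuclideanLin (rowSub G B)).singularValues (Fintype.card ι - 1)

/-- The smallest value of `σ_min(G[B, :])` over all optimal bases `B`. -/
def sigmaLow (G : Matrix ρ ι ℝ) (p : ι → ℝ) : ℝ :=
  sInf (sigmaMinB G '' optimalBases G p)

/-- The largest value of `σ_max(G[B, :])` over all optimal bases `B`. -/
def sigmaHigh (G : Matrix ρ ι ℝ) (p : ι → ℝ) : ℝ :=
  sSup (sigmaMaxB G '' optimalBases G p)

/-- `Γ = σ_high / σ_low²`. -/
def Gam (G : Matrix ρ ι ℝ) (p : ι → ℝ) : ℝ :=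
  sigmaHigh G p / sigmaLow G p ^ 2

/-- `ρ = (σ_high² - σ_low²) / (σ_high² + σ_low²)`. -/
def rate (G : Matrix ρ ι ℝ) (p : ι → ℝ) : ℝ :=
  (sigmaHigh G p ^ 2 - sigmaLow G p ^ 2) / (sigmaHigh G p ^ 2 + sigmaLow G p ^ 2)

end LP

/-! ### The MPC problem. Stages `1, …, N` are indexed by `Fin N`, i.e. shifted by one. -/

/-- Coordinates of a stage variable `z_i = (x_i, u_i)`. -/
abbrev Var (nx nu : ℕ) : Type := Fin nx ⊕ Fin nu

/-- Rows of a stage constraint; the stage data are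
`d_i = (v_i, -v_i, w_i, -w_i, xlow_i, -xhigh_i, ulow_i, -uhigh_i)`. -/
abbrev Row (nx nu nw : ℕ) : Type :=
  Fin nx ⊕ Fin nx ⊕ Fin nw ⊕ Fin nw ⊕ Fin nx ⊕ Fin nx ⊕ Fin nu ⊕ Fin nu

/-- The matrices of the MPC problem with dynamics `x_i = A_{i-1} x_{i-1} + B_{i-1} u_{i-1} + v_i`
and algebraic constraints `E_i x_i + F_i u_i = w_i` (`A`, `B` of the last stage are not used). -/
structure MPCSystem (N nx nu nw : ℕ) where
  A : Fin N → Matrix (Fin nx) (Fin nx) ℝ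
  B : Fin N → Matrix (Fin nx) (Fin nu) ℝ
  E : Fin N → Matrix (Fin nw) (Fin nx) ℝ
  F : Fin N → Matrix (Fin nw) (Fin nu) ℝ

variable {N K nx nu nw : ℕ}

/-- The diagonal block `G_{i,i}`. -/
def MPCSystem.Gdiag (S : MPCSystem N nx nu nw) (i : Fin N) :
    Matrix (Row nx nu nw) (Var nx nu) ℝ :=
  fromRows (fromCols 1 0) <|
  fromRows (fromCols (-1) 0) <|
  fromRows (fromCols (S.E i) (S.F i)) <|
  fromRows (fromCols (-S.E i) (-S.F i)) <|
  fromRows (fromCols 1 0) <|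
  fromRows (fromCols (-1) 0) <|
  fromRows (fromCols 0 1) (fromCols 0 (-1))

/-- The subdiagonal block `G_{j+1,j}`. -/
def MPCSystem.Gsub (S : MPCSystem N nx nu nw) (j : Fin N) :
    Matrix (Row nx nu nw) (Var nx nu) ℝ :=
  fromRows (fromCols (-S.A j) (-S.B j)) <|
  fromRows (fromCols (S.A j) (S.B j)) 0

/-- The full constraint matrix, with blocks `G_{i,i}`, `G_{i,i-1}` and `0` elsewhere. -/
def MPCSystem.G (S : MPCSystem N nx nu nw) :
    Matrix (Fin N × Row nx nu nw) (Fin N × Var nx nu) ℝ :=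
  fun r c =>
    if r.1 = c.1 then S.Gdiag c.1 r.2 c.2
    else if (r.1 : ℕ) = (c.1 : ℕ) + 1 then S.Gsub c.1 r.2 c.2
    else 0

/-- The `i`-th stage component of a stacked vector, with the Euclidean norm. -/
def stage {ι : Type*} (y : Fin N × ι → ℝ) (i : Fin N) : EuclideanSpace ℝ ι :=
  WithLp.toLp 2 (fun a => y (i, a))

/-! ### Coarsening -/

/-- A coarse grid of `K` points in `N` stages: `M k` (for `k < K`) is the first stage of the `k`-th
block, counted from `0`, and `M K = N` by convention. -/
structure CoarseGrid (N K : ℕ) where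
  M : Fin (K + 1) → ℕ
  strictMono : StrictMono M
  first : M 0 = 0
  last : M (Fin.last K) = N

/-- The `k`-th block of stages. -/
def CoarseGrid.block (g : CoarseGrid N K) (k : Fin K) : Finset (Fin N) :=
  Finset.univ.filter fun i => g.M k.castSucc ≤ (i : ℕ) ∧ (i : ℕ) < g.M k.succ

/-- The block diagonal coarsening operator, whose `k`-th diagonal block stacks `L_k` copies of
`L_k^{-1/2} I`, where `L_k` is the size of the `k`-th block of stages. -/
def CoarseGrid.op (g : CoarseGrid N K) (ι : Type*) [DecidableEq ι] :
    Matrix (Fin N × ι) (Fin K × ι) ℝ :=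
  fun r c => if r.1 ∈ g.block c.1 ∧ r.2 = c.2 then (√((g.block c.1).card : ℝ))⁻¹ else 0

/-- The operator `T`, which acts on primal variables. -/
def CoarseGrid.T (g : CoarseGrid N K) (nx nu : ℕ) :
    Matrix (Fin N × Var nx nu) (Fin K × Var nx nu) ℝ :=
  g.op (Var nx nu)

/-- The operator `U`, which acts on constraints. -/
def CoarseGrid.U (g : CoarseGrid N K) (nx nu nw : ℕ) :
    Matrix (Fin N × Row nx nu nw) (Fin K × Row nx nu nw) ℝ :=
  g.op (Row nx nu nw)

/-- Coarse constraint matrix `Uᵀ G T`. -/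
def coarseG (S : MPCSystem N nx nu nw) (g : CoarseGrid N K) :
    Matrix (Fin K × Row nx nu nw) (Fin K × Var nx nu) ℝ :=
  (g.U nx nu nw)ᵀ * S.G * g.T nx nu

/-- Coarse data `Uᵀ (d - G z°)`. -/
def coarseD (S : MPCSystem N nx nu nw) (g : CoarseGrid N K)
    (d : Fin N × Row nx nu nw → ℝ) (zo : Fin N × Var nx nu → ℝ) : Fin K × Row nx nu nw → ℝ :=
  (g.U nx nu nw)ᵀ *ᵥ (d - S.G *ᵥ zo)

/-- Coarse cost `Tᵀ (p - Gᵀ λ°)`. -/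
def coarseP (S : MPCSystem N nx nu nw) (g : CoarseGrid N K)
    (p : Fin N × Var nx nu → ℝ) (lo : Fin N × Row nx nu nw → ℝ) : Fin K × Var nx nu → ℝ :=
  (g.T nx nu)ᵀ *ᵥ (p - S.Gᵀ *ᵥ lo)

/-- The full-space vector `z° + T z̃`. -/
def project (g : CoarseGrid N K) (zo : Fin N × Var nx nu → ℝ) (zt : Fin K × Var nx nu → ℝ) :
    Fin N × Var nx nu → ℝ :=
  zo + g.T nx nu *ᵥ zt

/-- `z'` is a projected coarse solution: `z' = z° + T z̃` for a solution `z̃` of the coarse LP. -/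
def IsProjectedCoarseSolution (S : MPCSystem N nx nu nw) (g : CoarseGrid N K)
    (d : Fin N × Row nx nu nw → ℝ) (p : Fin N × Var nx nu → ℝ)
    (zo : Fin N × Var nx nu → ℝ) (lo : Fin N × Row nx nu nw → ℝ)
    (z' : Fin N × Var nx nu → ℝ) : Prop :=
  ∃ zt, IsSolution (coarseG S g) (coarseD S g d zo) (coarseP S g p lo) zt ∧ z' = project g zo zt

/-- Blocks of free variables: blocks of one stage at which the dual prior guess vanishes. -/
def freeBlocks (g : CoarseGrid N K) (lo : Fin N × Row nx nu nw → ℝ) : Finset (Fin K) :=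
  Finset.univ.filter fun k => (g.block k).card = 1 ∧ ∀ i ∈ g.block k, ∀ a, lo (i, a) = 0

/-- Stages of free variables. -/
def freeStages (g : CoarseGrid N K) (lo : Fin N × Row nx nu nw → ℝ) : Finset (Fin N) :=
  (freeBlocks g lo).biUnion g.block

/-- All residual norms `‖d_j - G_{j,j-1} z'_{j-1} - G_{j,j} z'_j‖`, where `j` is a stage and
`z' = z° + T z̃` with `z̃` feasible for the coarse LP. -/
def residualNorms (S : MPCSystem N nx nu nw) (g : CoarseGrid N K)
    (d : Fin N × Row nx nu nw → ℝ) (zo : Fin N × Var nx nu → ℝ) : Set ℝ :=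
  {t | ∃ zt, IsFeasible (coarseG S g) (coarseD S g d zo) zt ∧
    ∃ j, t = ‖stage (d - S.G *ᵥ project g zo zt) j‖}

/-- The maximal residual `Δ`. -/
def maxResidual (S : MPCSystem N nx nu nw) (g : CoarseGrid N K)
    (d : Fin N × Row nx nu nw → ℝ) (zo : Fin N × Var nx nu → ℝ) : ℝ :=
  sSup (residualNorms S g d zo)

end CoarseMPC

end

/-! The estimate compares two full-size programs with the same matrix. Let `z'` project a coarse
solution, and replace `d` by the data `d'` that equal `d` on the free stages and `G z'` elsewhere.
Every row of `G` occurs with both signs, so feasibility for `d'` forces `G y = G z'` off the free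
stages, and the box rows then give `y = z'` there. A free stage is a block of its own with zero dual
guess, so such a `y` is again a projected vector. If `y` is optimal for `d'`, its coarse cost is at
most that of `z'`. Hence solutions for `d'` are projected coarse solutions, and `d - d'` is zero on
the free stages and at most `Δ` in norm on each other stage.

Sensitivity of the program in its data (`exists_isSolution_norm_sub_le`): the cost is moved to a
nearby generic `q` that acquires no dual feasible basis which `p` lacks. For `q` solutions are
unique and basic. Along the segment between the two data vectors the solution is piecewise a basic
solution, over finitely many closed pieces, so its total change is controlled by the basic solutions
for the data difference, over bases in `optimalBases`.

Decay of a basic solution (`norm_stage_le_of_supported`): gradient descent on the normal equations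
of `G[B,:] x = e` contracts the error by `rate` per step, and bandedness lets the support of the
iterate grow by only one stage per step. If `e` lives on stage `j`, the iterate after `|i - j| - 1`
steps is still zero at stage `i`, so the error there is the whole of `x` at `i`. Summing over `j`
gives the bound. -/

noncomputable section

namespace CoarseMPC

open Filter Topology

/-! ### Finitely generated cones -/

section Cone

variable {ρ E : Type*} [AddCommGroup E] [Module ℝ E]

/-- The cone generated by the vectors `v b`, `b ∈ B`. -/
def coneOf (v : ρ → E) (B : Finset ρ) : Set E :=
  {x | ∃ c : ρ → ℝ, (∀ b ∈ B, 0 ≤ c b) ∧ ∑ b ∈ B, c b • v b = x}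

/-- A nontrivial relation or its negative has a positive coefficient; this makes the ratio test
below applicable. -/
theorem exists_pos_dependency {v : ρ → E} {A : Finset ρ}
    (h : ¬ LinearIndepOn ℝ v (A : Set ρ)) :
    ∃ t : ρ → ℝ, ∑ b ∈ A, t b • v b = 0 ∧ ∃ b ∈ A, 0 < t b := by
  rw [linearIndepOn_finset_iff] at h
  push Not at h
  obtain ⟨t, ht, b, hb, hne⟩ := h
  rcases lt_or_gt_of_ne hne with hlt | hgt
  · refine ⟨fun r => -t r, ?_, b, hb, by linarith⟩
    simp [neg_smul, ht]
  · exact ⟨t, ht, b, hb, hgt⟩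

/-- Carathéodory's theorem for cones: a member of a finitely generated cone is a strictly positive
combination of linearly independent generators. -/
theorem conic_caratheodory (v : ρ → E) (A : Finset ρ) (c : ρ → ℝ) (hc : ∀ r ∈ A, 0 ≤ c r) :
    ∃ B ⊆ A, ∃ c' : ρ → ℝ, LinearIndepOn ℝ v (B : Set ρ) ∧ (∀ r ∈ B, 0 < c' r) ∧
      ∑ r ∈ B, c' r • v r = ∑ r ∈ A, c r • v r := by
  classical
  induction A using Finset.strongInduction generalizing c with
  | H A ih =>
    -- A generator with coefficient zero can be erased, after which induction applies.
    have drop : ∀ c₁ : ρ → ℝ, (∀ r ∈ A, 0 ≤ c₁ r) → (∃ r ∈ A, c₁ r = 0) →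
        ∑ r ∈ A, c₁ r • v r = ∑ r ∈ A, c r • v r →
        ∃ B ⊆ A, ∃ c' : ρ → ℝ, LinearIndepOn ℝ v (B : Set ρ) ∧ (∀ r ∈ B, 0 < c' r) ∧
          ∑ r ∈ B, c' r • v r = ∑ r ∈ A, c r • v r := by
      rintro c₁ h₁ ⟨r, hr, hr0⟩ hs
      obtain ⟨B, hB, c', hl, hp, he⟩ := ih (A.erase r) (Finset.erase_ssubset hr) c₁
        (fun s hs => h₁ s (Finset.mem_of_mem_erase hs))
      refine ⟨B, hB.trans (Finset.erase_subset _ _), c', hl, hp, ?_⟩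
      rw [he, ← hs, ← Finset.add_sum_erase A _ hr, hr0]
      simp
    by_cases h0 : ∃ r ∈ A, c r = 0
    · exact drop c hc h0 rfl
    · push Not at h0
      by_cases hl : LinearIndepOn ℝ v (A : Set ρ)
      · exact ⟨A, subset_rfl, c, hl, fun r hr => lt_of_le_of_ne (hc r hr) (h0 r hr).symm, rfl⟩
      · obtain ⟨t, ht, b, hb, htb⟩ := exists_pos_dependency hl
        -- Ratio test: `c b₀ / t b₀` is the largest multiple of the relation that can be subtracted
        -- while all coefficients stay nonnegative, and it annihilates the one at `b₀`.
        obtain ⟨b₀, hb₀, hmin⟩ := Finset.exists_min_image (A.filter fun r => 0 < t r)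
          (fun r => c r / t r) ⟨b, by simp [hb, htb]⟩
        simp only [Finset.mem_filter] at hb₀ hmin
        have hq : 0 ≤ c b₀ / t b₀ := div_nonneg (hc _ hb₀.1) hb₀.2.le
        refine drop (fun r => c r - c b₀ / t b₀ * t r) (fun r hr => ?_) ⟨b₀, hb₀.1, ?_⟩ ?_
        · rcases le_or_gt (t r) 0 with hn | hp
          · have := mul_nonneg hq (neg_nonneg.2 hn)
            have := hc r hr
            linarith
          · have := (le_div_iff₀ hp).1 (hmin r ⟨hr, hp⟩)
            simpa using this
        · have := hb₀.2.ne'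
          field_simp
          simp
        · simp [sub_smul, Finset.sum_sub_distrib, mul_smul, ← Finset.smul_sum, ht]

variable [TopologicalSpace E] [IsTopologicalAddGroup E] [ContinuousSMul ℝ E] [T2Space E]

/-- The cone is the image of the closed orthant under an injective linear map from a
finite-dimensional space, which is a closed embedding. -/
theorem isClosed_coneOf_of_linearIndepOn {v : ρ → E} {B : Finset ρ}
    (h : LinearIndepOn ℝ v (B : Set ρ)) : IsClosed (coneOf v B) := by
  classical
  let f : (B → ℝ) →ₗ[ℝ] E := Fintype.linearCombination ℝ (fun b : B => v b)
  have hf : Topology.IsClosedEmbedding f := by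
    refine LinearMap.isClosedEmbedding_of_injective ?_
    rw [LinearMap.ker_eq_bot]
    exact LinearIndependent.fintypeLinearCombination_injective h
  have : coneOf v B = f '' Set.Ici 0 := by
    ext x
    constructor
    · rintro ⟨c, hc, rfl⟩
      refine ⟨fun b => c b, fun b => hc b b.2, ?_⟩
      simp only [f, Fintype.linearCombination_apply]
      exact Finset.sum_coe_sort B fun b => c b • v b
    · rintro ⟨c, hc, rfl⟩
      refine ⟨fun b => if hb : b ∈ B then c ⟨b, hb⟩ else 0, fun b hb => ?_, ?_⟩
      · simpa [hb] using hc ⟨b, hb⟩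
      · simp only [f, Fintype.linearCombination_apply]
        rw [← Finset.sum_coe_sort B]
        simp
  rw [this]
  exact hf.isClosedMap _ isClosed_Ici

/-- By Carathéodory, the cone is a finite union of cones on independent generators. -/
theorem isClosed_coneOf (v : ρ → E) (A : Finset ρ) : IsClosed (coneOf v A) := by
  classical
  have : coneOf v A = ⋃ B ∈ A.powerset.filter (fun B : Finset ρ => LinearIndepOn ℝ v (B : Set ρ)),
      coneOf v B := by
    ext x
    simp only [Set.mem_iUnion, Finset.mem_filter, Finset.mem_powerset, exists_prop]
    constructor
    · rintro ⟨c, hc, rfl⟩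
      obtain ⟨B, hB, c', hl, hp, he⟩ := conic_caratheodory v A c hc
      exact ⟨B, ⟨hB, hl⟩, c', fun b hb => (hp b hb).le, he⟩
    · rintro ⟨B, ⟨hB, -⟩, c, hc, rfl⟩
      refine ⟨fun b => if b ∈ B then c b else 0, fun b _ => ?_, ?_⟩
      · dsimp only
        split_ifs with h
        exacts [hc b h, le_rfl]
      · simp only [ite_smul, zero_smul]
        rw [← Finset.sum_filter, Finset.filter_mem_eq_inter, Finset.inter_eq_right.2 hB]
  rw [this]
  refine Set.Finite.isClosed_biUnion (Finset.finite_toSet _) fun B hB => ?_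
  exact isClosed_coneOf_of_linearIndepOn (by simpa using (Finset.mem_filter.1 hB).2)

/-- Farkas' lemma. -/
theorem exists_dual_of_notMem_coneOf [LocallyConvexSpace ℝ E] {v : ρ → E} {A : Finset ρ} {p : E}
    (h : p ∉ coneOf v A) :
    ∃ f : StrongDual ℝ E, (∀ r ∈ A, 0 ≤ f (v r)) ∧ f p < 0 := by
  classical
  let C : ProperCone ℝ E :=
    { carrier := coneOf v A
      add_mem' := by
        rintro _ _ ⟨c, hc, rfl⟩ ⟨c', hc', rfl⟩
        exact ⟨fun r => c r + c' r, fun b hb => add_nonneg (hc b hb) (hc' b hb),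
          by simp [add_smul, Finset.sum_add_distrib]⟩
      zero_mem' := ⟨0, by simp, by simp⟩
      smul_mem' := by
        rintro a _ ⟨c, hc, rfl⟩
        refine ⟨fun r => a * c r, fun b hb => mul_nonneg a.2 (hc b hb), ?_⟩
        simp only [mul_smul, ← Finset.smul_sum]
        rfl
      isClosed' := isClosed_coneOf v A }
  obtain ⟨f, hf, hp⟩ := C.hyperplane_separation_point h
  refine ⟨f, fun r hr => hf _ ⟨Pi.single r 1, fun b _ => ?_, ?_⟩, hp⟩
  · by_cases hb : b = r
    · subst hb; simp
    · simp [hb]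
  · rw [Finset.sum_eq_single r]
    · simp
    · intro b _ hb; simp [hb]
    · exact fun h => absurd hr h

end Cone

/-! ### Linear programs -/

section LPTheory

variable {ρ ι : Type*} [Fintype ι]

theorem sum_smul_row_dotProduct (G : Matrix ρ ι ℝ) (B : Finset ρ) (c : ρ → ℝ) (z : ι → ℝ) :
    (∑ b ∈ B, c b • G.row b) ⬝ᵥ z = ∑ b ∈ B, c b * (G *ᵥ z) b := by
  rw [sum_dotProduct]
  exact Finset.sum_congr rfl fun b _ => smul_dotProduct _ _ _

theorem IsBasicSolution.mulVec_eq {G : Matrix ρ ι ℝ} {d : ρ → ℝ} {B : Finset ρ} {z : ι → ℝ}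
    (h : IsBasicSolution G d B z) {b : ρ} (hb : b ∈ B) : (G *ᵥ z) b = d b :=
  congrFun h ⟨b, hb⟩

/-- A feasible basic solution of a dual feasible basis is optimal. -/
theorem isSolution_of_mem_coneOf {G : Matrix ρ ι ℝ} {d : ρ → ℝ} {p : ι → ℝ} {B : Finset ρ}
    {z : ι → ℝ} (hp : p ∈ coneOf G.row B) (hb : IsBasicSolution G d B z)
    (hz : IsFeasible G d z) : IsSolution G d p z := by
  obtain ⟨c, hc, rfl⟩ := hp
  refine ⟨hz, fun y hy => ?_⟩
  rw [sum_smul_row_dotProduct, sum_smul_row_dotProduct]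
  exact Finset.sum_le_sum fun b hB =>
    mul_le_mul_of_nonneg_left ((hb.mulVec_eq hB).trans_le (hy b)) (hc b hB)

/-- The necessary optimality condition: the cost is in the cone of the active rows. -/
theorem IsSolution.mem_coneOf_active [Fintype ρ] {G : Matrix ρ ι ℝ} {d : ρ → ℝ} {p : ι → ℝ}
    {z : ι → ℝ} (h : IsSolution G d p z) :
    p ∈ coneOf G.row (Finset.univ.filter fun r => (G *ᵥ z) r = d r) := by
  classical
  by_contra hp
  obtain ⟨f, hf, hfp⟩ := exists_dual_of_notMem_coneOf hp
  let y : ι → ℝ := fun i => f fun j => if i = j then 1 else 0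
  have hy : ∀ x : ι → ℝ, f x = x ⬝ᵥ y := by
    intro x
    exact LinearMap.pi_apply_eq_sum_univ (f : (ι → ℝ) →ₗ[ℝ] ℝ) x
  -- The separating vector `y` is a descent direction: active rows do not decrease along it, and
  -- inactive rows have slack for a short step.
  have hev : ∀ᶠ t in 𝓝[>] (0 : ℝ), ∀ r, d r ≤ (G *ᵥ z) r + t * (G *ᵥ y) r := by
    rw [eventually_all]
    intro r
    rcases (h.1 r).eq_or_lt with he | hlt
    · have hr : 0 ≤ (G *ᵥ y) r := by
        have := hf r (by simp [he])
        rwa [hy] at this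
      filter_upwards [self_mem_nhdsWithin] with t ht
      rw [← he]
      have := mul_nonneg (le_of_lt (Set.mem_Ioi.1 ht)) hr
      linarith
    · have hcont : Continuous fun t : ℝ => (G *ᵥ z) r + t * (G *ᵥ y) r := by fun_prop
      have := (hcont.tendsto 0).eventually (lt_mem_nhds (a := d r) (by simpa using hlt))
      exact (this.filter_mono nhdsWithin_le_nhds).mono fun _ => le_of_lt
  obtain ⟨t, ht, ht0⟩ := (hev.and self_mem_nhdsWithin).exists
  have hle := h.2 (z + t • y) (fun r => by
    simpa [mulVec_add, mulVec_smul] using ht r)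
  rw [dotProduct_add, dotProduct_smul, ← hy, smul_eq_mul] at hle
  have := mul_neg_of_pos_of_neg (Set.mem_Ioi.1 ht0) hfp
  linarith

theorem isBasis_of_linearIndepOn {G : Matrix ρ ι ℝ} {B : Finset ρ}
    (hl : LinearIndepOn ℝ G.row (B : Set ρ))
    (hs : Submodule.span ℝ (G.row '' (B : Set ρ)) = ⊤) : IsBasis G B := by
  classical
  have hs' : ⊤ ≤ Submodule.span ℝ (Set.range fun b : (B : Set ρ) => G.row b) := by
    rw [← hs, Set.image_eq_range]
  have hcard := Module.finrank_eq_card_basis (Module.Basis.mk hl hs')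
  have hinj : Function.Injective (rowSub G B).mulVecLin := by
    rw [injective_iff_map_eq_zero]
    intro z hz
    have hz' : ∀ b ∈ B, G.row b ⬝ᵥ z = 0 := fun b hb => congrFun hz ⟨b, hb⟩
    have : ∀ x ∈ Submodule.span ℝ (G.row '' (B : Set ρ)), x ⬝ᵥ z = 0 := by
      intro x hx
      induction hx using Submodule.span_induction with
      | mem x hx => obtain ⟨b, hb, rfl⟩ := hx; exact hz' b hb
      | zero => simp
      | add x y _ _ hx hy => rw [add_dotProduct, hx, hy, add_zero]
      | smul a x _ hx => rw [smul_dotProduct, hx, smul_zero]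
    -- The rows span everything, so a vector orthogonal to them is orthogonal to itself.
    exact dotProduct_self_eq_zero.1 (this z (by rw [hs]; trivial))
  have hsurj := (LinearMap.injective_iff_surjective_of_finrank_eq_finrank (by
    rw [hcard]; simp)).1 hinj
  exact ⟨hinj, hsurj⟩

/-- The basic solution as a linear function of the data. -/
def basicSolution {G : Matrix ρ ι ℝ} {B : Finset ρ} (hB : IsBasis G B) :
    (ρ → ℝ) →ₗ[ℝ] (ι → ℝ) :=
  (LinearEquiv.ofBijective (rowSub G B).mulVecLin hB).symm.toLinearMap ∘ₗ
    LinearMap.funLeft ℝ ℝ (fun b : B => (b : ρ))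

theorem isBasicSolution_basicSolution {G : Matrix ρ ι ℝ} {B : Finset ρ} (hB : IsBasis G B)
    (d : ρ → ℝ) : IsBasicSolution G d B (basicSolution hB d) :=
  (LinearEquiv.ofBijective (rowSub G B).mulVecLin hB).apply_symm_apply _

theorem IsBasicSolution.eq_basicSolution {G : Matrix ρ ι ℝ} {B : Finset ρ} (hB : IsBasis G B)
    {d : ρ → ℝ} {z : ι → ℝ} (h : IsBasicSolution G d B z) : z = basicSolution hB d :=
  hB.1 (h.trans (isBasicSolution_basicSolution hB d).symm)

/-- A cost that lies in no proper subspace spanned by rows. -/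
def IsGeneric (G : Matrix ρ ι ℝ) (p : ι → ℝ) : Prop :=
  ∀ B : Finset ρ, p ∈ Submodule.span ℝ (G.row '' (B : Set ρ)) →
    Submodule.span ℝ (G.row '' (B : Set ρ)) = ⊤

/-- For a generic cost, optimal solutions are unique and come from dual feasible bases. -/
theorem IsGeneric.exists_basis [Fintype ρ] {G : Matrix ρ ι ℝ} {p : ι → ℝ} (hp : IsGeneric G p)
    {d : ρ → ℝ} {z : ι → ℝ} (hz : IsSolution G d p z) :
    ∃ B : Finset ρ, IsBasis G B ∧ p ∈ coneOf G.row B ∧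
      ∀ y, IsSolution G d p y → IsBasicSolution G d B y := by
  obtain ⟨c, hc, hcp⟩ := hz.mem_coneOf_active
  obtain ⟨B, hB, c', hl, hpos, he⟩ := conic_caratheodory G.row _ c hc
  rw [hcp] at he
  have hspan := hp B (by
    rw [← he]
    exact Submodule.sum_mem _ fun b hb =>
      Submodule.smul_mem _ _ (Submodule.subset_span ⟨b, hb, rfl⟩))
  refine ⟨B, isBasis_of_linearIndepOn hl hspan, ⟨c', fun b hb => (hpos b hb).le, he⟩, ?_⟩
  intro y hy
  have hle := hy.2 z hz.1
  rw [← he, sum_smul_row_dotProduct, sum_smul_row_dotProduct] at hle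
  have hact : ∀ b ∈ B, (G *ᵥ z) b = d b := fun b hb => (Finset.mem_filter.1 (hB hb)).2
  have hterm : ∀ b ∈ B, c' b * (G *ᵥ z) b ≤ c' b * (G *ᵥ y) b := fun b hb =>
    mul_le_mul_of_nonneg_left ((hact b hb).trans_le (hy.1 b)) (hpos b hb).le
  -- Complementary slackness: equal costs and strictly positive multipliers make every row of `B`
  -- tight at `y` too.
  have heq := (Finset.sum_eq_sum_iff_of_le hterm).1 (le_antisymm (Finset.sum_le_sum hterm) hle)
  funext b
  have := mul_left_cancel₀ (hpos b b.2).ne' (heq b b.2)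
  exact this.symm.trans (hact b b.2)

/-- Any cost is approximated by a generic one without new dual feasible bases. -/
theorem exists_isGeneric [Fintype ρ] (G : Matrix ρ ι ℝ) (p : ι → ℝ) :
    ∃ q, IsGeneric G q ∧ ∀ B : Finset ρ, q ∈ coneOf G.row B → p ∈ coneOf G.row B := by
  classical
  -- A proper subspace is closed with empty interior, so avoiding finitely many of them is a dense
  -- condition.
  have hdense : Dense (⋂ B : {B : Finset ρ // Submodule.span ℝ (G.row '' (B : Set ρ)) ≠ ⊤},
      ((Submodule.span ℝ (G.row '' (B.1 : Set ρ)) : Set (ι → ℝ)))ᶜ) := by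
    refine dense_iInter_of_isOpen (fun B => ?_) (fun B => ?_)
    · exact (Submodule.closed_of_finiteDimensional _).isOpen_compl
    · rw [← interior_eq_empty_iff_dense_compl]
      by_contra hne
      exact B.2 (Submodule.eq_top_of_nonempty_interior' _ (Set.nonempty_iff_ne_empty.2 hne))
  -- The finitely many closed cones that miss `p` are also missed by all costs near `p`.
  have hopen : IsOpen (⋂ B : {B : Finset ρ // p ∉ coneOf G.row B}, (coneOf G.row B.1)ᶜ) :=
    isOpen_iInter_of_finite fun B => (isClosed_coneOf _ _).isOpen_compl
  obtain ⟨q, hq, hq'⟩ := hdense.inter_open_nonempty _ hopen ⟨p, by simp⟩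
  simp only [Set.mem_iInter, Set.mem_compl_iff, SetLike.mem_coe, Subtype.forall] at hq hq'
  refine ⟨q, fun B hB => ?_, fun B hB => ?_⟩
  · by_contra h
    exact hq' B h hB
  · by_contra h
    exact hq B h hB

/-- A function on `[0, 1]` which is Lipschitz on each member of a finite closed cover is
Lipschitz across the interval. -/
theorem norm_sub_le_of_closed_cover {κ F : Type*} [Finite κ] [SeminormedAddCommGroup F]
    {f : ℝ → F} {C : κ → Set ℝ} (hC : ∀ k, IsClosed (C k)) (hcov : Set.Icc 0 1 ⊆ ⋃ k, C k) {L : ℝ}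
    (hf : ∀ k, ∀ s ∈ C k ∩ Set.Icc 0 1, ∀ t ∈ C k ∩ Set.Icc 0 1, ‖f s - f t‖ ≤ L * |s - t|) :
    ‖f 1 - f 0‖ ≤ L := by
  have hcont : ContinuousOn f (Set.Icc 0 1) := by
    have h1 : ContinuousOn f (⋃ k, C k ∩ Set.Icc 0 1) := by
      refine (locallyFinite_of_finite _).continuousOn_iUnion
        (fun k => (hC k).inter isClosed_Icc) fun k => ?_
      have hL : LipschitzOnWith (Real.toNNReal L) f (C k ∩ Set.Icc 0 1) := by
        refine LipschitzOnWith.of_dist_le_mul fun s hs t ht => ?_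
        rw [dist_eq_norm, Real.dist_eq]
        exact (hf k s hs t ht).trans
          (mul_le_mul_of_nonneg_right (Real.le_coe_toNNReal L) (abs_nonneg _))
      exact hL.continuousOn
    refine h1.mono fun s hs => ?_
    obtain ⟨k, hk⟩ := Set.mem_iUnion.1 (hcov hs)
    exact Set.mem_iUnion.2 ⟨k, hk, hs⟩
  have key := image_le_of_liminf_slope_right_le_deriv_boundary (f := fun s => ‖f s - f 0‖)
    (a := 0) (b := 1) (B := fun s => L * s) (B' := fun _ => L)
    ((hcont.sub continuousOn_const).norm) (by simp) (by fun_prop)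
    (fun x _ => by simpa using ((hasDerivAt_id x).const_mul L).hasDerivWithinAt) ?_
    (Set.right_mem_Icc.2 zero_le_one)
  · simpa using key
  · intro x hx r hr
    have hmem : ∀ᶠ t in 𝓝[>] x, t ∈ Set.Icc (0 : ℝ) 1 := by
      filter_upwards [Ioc_mem_nhdsGT hx.2] with t ht
      exact ⟨hx.1.trans ht.1.le, ht.2⟩
    -- Pigeonhole: some piece is met arbitrarily close to the right of `x`. Being closed it contains
    -- `x`, so its Lipschitz bound controls the right slopes at `x`.
    have hfreq : ∃ k, ∃ᶠ t in 𝓝[>] x, t ∈ C k := by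
      by_contra hno
      push Not at hno
      have hall : ∀ᶠ t in 𝓝[>] x, ∀ k, t ∉ C k := by
        rw [eventually_all]
        exact hno
      obtain ⟨t, ht, ht'⟩ := (hall.and hmem).exists
      obtain ⟨k, hk⟩ := Set.mem_iUnion.1 (hcov ht')
      exact ht k hk
    obtain ⟨k, hk⟩ := hfreq
    have hxk : x ∈ C k := (hC k).mem_of_frequently_of_tendsto hk
      (tendsto_id.mono_left nhdsWithin_le_nhds)
    refine (hk.and_eventually (hmem.and self_mem_nhdsWithin)).mono ?_
    rintro t ⟨htk, ht, hxt⟩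
    have hxt : 0 < t - x := sub_pos.2 hxt
    rw [slope_def_field, div_lt_iff₀ hxt]
    have h1 := hf k t ⟨htk, ht⟩ x ⟨hxk, hx.1, hx.2.le⟩
    rw [abs_of_pos hxt] at h1
    have h2 : ‖f t - f 0‖ ≤ ‖f t - f x‖ + ‖f x - f 0‖ := by
      simpa using norm_add_le (f t - f x) (f x - f 0)
    have h3 := mul_lt_mul_of_pos_right hr hxt
    linarith

theorem exists_isSolution {G : Matrix ρ ι ℝ} {d : ρ → ℝ}
    (hc : IsCompact {z | IsFeasible G d z}) (hd : d ∈ admissible G) (p : ι → ℝ) :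
    ∃ z, IsSolution G d p z := by
  obtain ⟨z, hz, hmin⟩ := hc.exists_isMinOn hd
    (f := fun z => p ⬝ᵥ z) (by unfold dotProduct; fun_prop)
  exact ⟨z, hz, fun y hy => hmin hy⟩

theorem isClosed_isFeasible (G : Matrix ρ ι ℝ) (d : ρ → ℝ) : IsClosed {z | IsFeasible G d z} := by
  simp only [IsFeasible, Set.ofPred_forall]
  exact isClosed_iInter fun r => isClosed_le continuous_const
    ((continuous_apply r).comp (continuous_const.matrix_mulVec continuous_id))

/-- The program for `p` itself may offer no basis directly; a generic nearby cost does, and its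
basis remains dual feasible for `p`. -/
theorem nonempty_optimalBases [Fintype ρ] {G : Matrix ρ ι ℝ} {d : ρ → ℝ}
    (hc : IsCompact {z | IsFeasible G d z}) (hd : d ∈ admissible G) (p : ι → ℝ) :
    (optimalBases G p).Nonempty := by
  obtain ⟨q, hq, hqp⟩ := exists_isGeneric G p
  obtain ⟨z, hz⟩ := exists_isSolution hc hd q
  obtain ⟨B, hB, hqB, hs⟩ := hq.exists_basis hz
  exact ⟨B, d, hd, hB, z, hs z hz, isSolution_of_mem_coneOf (hqp B hqB) (hs z hz) hz.1⟩

/-- Sensitivity of linear programs: two data vectors have optimal solutions whose difference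
is bounded in terms of the basic solutions for the difference of the data. -/
theorem exists_isSolution_norm_sub_le [Fintype ρ] {G : Matrix ρ ι ℝ} (p : ι → ℝ)
    (hc : ∀ d, IsCompact {z | IsFeasible G d z}) {d d' : ρ → ℝ} (hd : d ∈ admissible G)
    (hd' : d' ∈ admissible G) :
    ∃ z z', IsSolution G d p z ∧ IsSolution G d' p z' ∧
      ∀ {F : Type} [SeminormedAddCommGroup F] [NormedSpace ℝ F] (π : (ι → ℝ) →ₗ[ℝ] F) (L : ℝ),
        (∀ B ∈ optimalBases G p, ∀ x, IsBasicSolution G (d' - d) B x → ‖π x‖ ≤ L) →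
        ‖π z' - π z‖ ≤ L := by
  obtain ⟨q, hq, hqp⟩ := exists_isGeneric G p
  let D : ℝ → ρ → ℝ := fun s => d + s • (d' - d)
  have hD0 : D 0 = d := by simp [D]
  have hD1 : D 1 = d' := by simp [D]
  have hDadm : ∀ s ∈ Set.Icc (0 : ℝ) 1, D s ∈ admissible G := by
    obtain ⟨y, hy⟩ := hd
    obtain ⟨y', hy'⟩ := hd'
    intro s hs
    refine ⟨(1 - s) • y + s • y', fun r => ?_⟩
    have h1 := mul_le_mul_of_nonneg_left (hy r) (sub_nonneg.2 hs.2)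
    have h2 := mul_le_mul_of_nonneg_left (hy' r) hs.1
    simp only [D, mulVec_add, mulVec_smul, Pi.add_apply, Pi.smul_apply, Pi.sub_apply, smul_eq_mul]
    linarith
  have hsol : ∀ s : Set.Icc (0 : ℝ) 1, ∃ z, IsSolution G (D s) q z := fun s =>
    exists_isSolution (hc _) (hDadm s s.2) q
  choose f' hf' using hsol
  let f : ℝ → ι → ℝ := fun s => if hs : s ∈ Set.Icc (0 : ℝ) 1 then f' ⟨s, hs⟩ else 0
  have hf : ∀ s ∈ Set.Icc (0 : ℝ) 1, IsSolution G (D s) q (f s) := fun s hs => by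
    simp only [f, dif_pos hs]
    exact hf' ⟨s, hs⟩
  have huniq : ∀ s ∈ Set.Icc (0 : ℝ) 1, ∀ y, IsSolution G (D s) q y → y = f s := by
    intro s hs y hy
    obtain ⟨B, hB, -, h⟩ := hq.exists_basis hy
    rw [(h y hy).eq_basicSolution hB, (h _ (hf s hs)).eq_basicSolution hB]
  have hopt : ∀ s ∈ Set.Icc (0 : ℝ) 1, IsSolution G (D s) p (f s) := by
    intro s hs
    obtain ⟨B, hB, hqB, h⟩ := hq.exists_basis (hf s hs)
    exact isSolution_of_mem_coneOf (hqp B hqB) (h _ (hf s hs)) (hf s hs).1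
  refine ⟨f 0, f 1, ?_, ?_, ?_⟩
  · simpa [hD0] using hopt 0 (by simp)
  · simpa [hD1] using hopt 1 (by simp)
  -- The pair `f 0`, `f 1` is fixed before `π`, so one pair serves all stages.
  intro F _ _ π L hL
  let κ := {B : Finset ρ // IsBasis G B ∧ q ∈ coneOf G.row B}
  -- Dual feasibility does not depend on the data, so primal feasibility of the basic solution is
  -- all that optimality requires.
  let C : κ → Set ℝ := fun B => {s | IsFeasible G (D s) (basicSolution B.2.1 (D s))}
  have hbas : ∀ (B : κ), ∀ s ∈ C B ∩ Set.Icc 0 1, f s = basicSolution B.2.1 (D s) := by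
    rintro B s ⟨hsC, hs⟩
    exact (huniq s hs _ (isSolution_of_mem_coneOf B.2.2
      (isBasicSolution_basicSolution _ _) hsC)).symm
  have hDcont : Continuous D := by
    simp only [D]
    fun_prop
  refine norm_sub_le_of_closed_cover (f := fun s => π (f s)) (C := C) (fun B => ?_) ?_ ?_
  · have hcont : Continuous fun s => basicSolution B.2.1 (D s) :=
      (LinearMap.continuous_of_finiteDimensional _).comp hDcont
    simp only [C, IsFeasible, Set.ofPred_forall]
    exact isClosed_iInter fun r => isClosed_le ((continuous_apply r).comp hDcont)
      ((continuous_apply r).comp (continuous_const.matrix_mulVec hcont))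
  · intro s hs
    obtain ⟨B, hB, hqB, h⟩ := hq.exists_basis (hf s hs)
    refine Set.mem_iUnion.2 ⟨⟨B, hB, hqB⟩, ?_⟩
    change IsFeasible G (D s) (basicSolution hB (D s))
    rw [← (h _ (hf s hs)).eq_basicSolution hB]
    exact (hf s hs).1
  · intro B s hs t ht
    have hBopt : B.1 ∈ optimalBases G p := by
      refine ⟨D s, hDadm s hs.2, B.2.1, f s, ?_, hopt s hs.2⟩
      rw [hbas B s hs]
      exact isBasicSolution_basicSolution _ _
    have hdiff : f s - f t = (s - t) • basicSolution B.2.1 (d' - d) := by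
      rw [hbas B s hs, hbas B t ht, ← map_sub, ← map_smul]
      congr 1
      simp only [D]
      module
    rw [← map_sub, hdiff, map_smul, norm_smul, Real.norm_eq_abs, mul_comm]
    exact mul_le_mul_of_nonneg_right
      (hL B.1 hBopt _ (isBasicSolution_basicSolution _ _)) (abs_nonneg _)

end LPTheory

/-! ### Spectral bounds from singular values -/

section Spectral

variable {E F : Type*} [NormedAddCommGroup E] [InnerProductSpace ℝ E] [FiniteDimensional ℝ E]
  [NormedAddCommGroup F] [InnerProductSpace ℝ F] [FiniteDimensional ℝ F]

theorem eigenvalues_mem_Icc (T : E →ₗ[ℝ] F) {a b : ℝ} (ha : 0 ≤ a)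
    (hmin : a ≤ T.singularValues (Module.finrank ℝ E - 1)) (hmax : T.singularValues 0 ≤ b)
    (i : Fin (Module.finrank ℝ E)) :
    T.isSymmetric_adjoint_comp_self.eigenvalues rfl i ∈ Set.Icc (a ^ 2) (b ^ 2) := by
  rw [← T.sq_singularValues_fin rfl i]
  have h1 : a ≤ T.singularValues i :=
    hmin.trans (T.singularValues_antitone (Nat.le_sub_one_of_lt i.2))
  have h2 : T.singularValues i ≤ b := (T.singularValues_antitone (Nat.zero_le _)).trans hmax
  exact ⟨pow_le_pow_left₀ ha h1 2, pow_le_pow_left₀ (ha.trans h1) h2 2⟩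

/-- In an eigenbasis of `T* T`, `‖T x‖²` is a sum of squared coordinates weighted by squared
singular values. -/
theorem mul_norm_le_norm_apply (T : E →ₗ[ℝ] F) {a : ℝ} (ha : 0 ≤ a)
    (hmin : a ≤ T.singularValues (Module.finrank ℝ E - 1)) (x : E) : a * ‖x‖ ≤ ‖T x‖ := by
  let H := T.isSymmetric_adjoint_comp_self
  let v := H.eigenvectorBasis rfl
  have hx : ‖x‖ ^ 2 = ∑ i, v.repr x i ^ 2 := by
    rw [← v.repr.norm_map x, EuclideanSpace.real_norm_sq_eq]
  have hT : ‖T x‖ ^ 2 = ∑ i, H.eigenvalues rfl i * v.repr x i ^ 2 := by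
    have h1 : ‖T x‖ ^ 2 = inner ℝ x ((LinearMap.adjoint T ∘ₗ T) x) := by
      rw [LinearMap.comp_apply, LinearMap.adjoint_inner_right, real_inner_self_eq_norm_sq]
    rw [h1, ← v.repr.inner_map_map, PiLp.inner_apply]
    refine Finset.sum_congr rfl fun i _ => ?_
    rw [H.eigenvectorBasis_apply_self_apply]
    simp only [RCLike.inner_apply, conj_trivial, RCLike.ofReal_real_eq_id, id_eq]
    ring
  refine le_of_sq_le_sq ?_ (norm_nonneg _)
  rw [mul_pow, hx, hT, Finset.mul_sum]
  exact Finset.sum_le_sum fun i _ => mul_le_mul_of_nonneg_right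
    (eigenvalues_mem_Icc T ha hmin le_rfl i).1 (sq_nonneg _)

/-- One step of the gradient iteration with the optimal step size is a contraction. -/
theorem norm_sub_smul_adjoint_comp_le (T : E →ₗ[ℝ] F) {a b : ℝ} (ha : 0 < a) (hab : a ≤ b)
    (hmin : a ≤ T.singularValues (Module.finrank ℝ E - 1)) (hmax : T.singularValues 0 ≤ b)
    (x : E) : ‖x - (2 / (b ^ 2 + a ^ 2)) • LinearMap.adjoint T (T x)‖ ≤
      (b ^ 2 - a ^ 2) / (b ^ 2 + a ^ 2) * ‖x‖ := by
  let H := T.isSymmetric_adjoint_comp_self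
  let v := H.eigenvectorBasis rfl
  have hab2 : a ^ 2 ≤ b ^ 2 := pow_le_pow_left₀ ha.le hab 2
  have hs : 0 < b ^ 2 + a ^ 2 := by positivity
  refine le_of_sq_le_sq ?_ (mul_nonneg (div_nonneg (sub_nonneg.2 hab2) hs.le) (norm_nonneg _))
  rw [mul_pow, ← v.repr.norm_map, ← v.repr.norm_map x, EuclideanSpace.real_norm_sq_eq,
    EuclideanSpace.real_norm_sq_eq, Finset.mul_sum]
  refine Finset.sum_le_sum fun i _ => ?_
  have hi : v.repr (x - (2 / (b ^ 2 + a ^ 2)) • LinearMap.adjoint T (T x)) i =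
      (1 - 2 / (b ^ 2 + a ^ 2) * H.eigenvalues rfl i) * v.repr x i := by
    rw [map_sub, map_smul, PiLp.sub_apply, PiLp.smul_apply, ← LinearMap.comp_apply,
      H.eigenvectorBasis_apply_self_apply]
    simp only [RCLike.ofReal_real_eq_id, id_eq, smul_eq_mul]
    ring
  rw [hi, mul_pow]
  refine mul_le_mul_of_nonneg_right ?_ (sq_nonneg _)
  obtain ⟨h1, h2⟩ := eigenvalues_mem_Icc T ha.le hmin hmax i
  rw [sq_le_sq, abs_of_nonneg (a := (b ^ 2 - a ^ 2) / _) (div_nonneg (sub_nonneg.2 hab2) hs.le),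
    abs_le]
  -- The eigenvalue of the iteration, `1 - 2λ/(b² + a²)`, is affine in `λ`; its extremes at `λ = b²`
  -- and `λ = a²` are minus and plus the rate.
  constructor
  · rw [← neg_div, div_le_iff₀ hs, sub_mul, mul_right_comm, div_mul_cancel₀ _ hs.ne']
    linarith
  · rw [le_div_iff₀ hs, sub_mul, mul_right_comm, div_mul_cancel₀ _ hs.ne']
    linarith

/-- Error of the gradient iteration for the normal equations of `T x = e`. -/
theorem norm_sub_iterate_le (T : E →ₗ[ℝ] F) {a b : ℝ} (ha : 0 < a) (hab : a ≤ b)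
    (hmin : a ≤ T.singularValues (Module.finrank ℝ E - 1)) (hmax : T.singularValues 0 ≤ b)
    {x : E} {e : F} (hx : T x = e) (m : ℕ) :
    ‖x - (fun y => y + (2 / (b ^ 2 + a ^ 2)) • LinearMap.adjoint T (e - T y))^[m] 0‖ ≤
      ((b ^ 2 - a ^ 2) / (b ^ 2 + a ^ 2)) ^ m * ‖x‖ := by
  have hab2 : a ^ 2 ≤ b ^ 2 := pow_le_pow_left₀ ha.le hab 2
  have hr : 0 ≤ (b ^ 2 - a ^ 2) / (b ^ 2 + a ^ 2) :=
    div_nonneg (sub_nonneg.2 hab2) (by positivity)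
  induction m with
  | zero => simp
  | succ m ih =>
    rw [Function.iterate_succ_apply']
    set y := (fun y => y + (2 / (b ^ 2 + a ^ 2)) • LinearMap.adjoint T (e - T y))^[m] 0
    have : x - (y + (2 / (b ^ 2 + a ^ 2)) • LinearMap.adjoint T (e - T y)) =
        (x - y) - (2 / (b ^ 2 + a ^ 2)) • LinearMap.adjoint T (T (x - y)) := by
      rw [map_sub T, hx]
      abel
    rw [this, pow_succ' ((b ^ 2 - a ^ 2) / _), mul_assoc]
    exact (norm_sub_smul_adjoint_comp_le T ha hab hmin hmax _).trans
      (mul_le_mul_of_nonneg_left ih hr)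

end Spectral

/-! ### The constants -/

theorem sigmaLow_nonneg {ρ ι : Type*} [Fintype ι] [DecidableEq ι] (G : Matrix ρ ι ℝ) (p : ι → ℝ) : 0 ≤ sigmaLow G p := by
  refine Real.sInf_nonneg ?_
  rintro _ ⟨B, -, rfl⟩
  exact LinearMap.singularValues_nonneg _ _

section Constants

variable {ρ ι : Type*} [Fintype ρ] [Fintype ι] [DecidableEq ι]

theorem isLeast_sigmaLow {G : Matrix ρ ι ℝ} {p : ι → ℝ} (h : (optimalBases G p).Nonempty) :
    IsLeast (sigmaMinB G '' optimalBases G p) (sigmaLow G p) :=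
  have hf := (Set.toFinite (optimalBases G p)).image (sigmaMinB G)
  ⟨(h.image _).csInf_mem hf, fun _ hx => csInf_le hf.bddBelow hx⟩

theorem isGreatest_sigmaHigh {G : Matrix ρ ι ℝ} {p : ι → ℝ} (h : (optimalBases G p).Nonempty) :
    IsGreatest (sigmaMaxB G '' optimalBases G p) (sigmaHigh G p) :=
  have hf := (Set.toFinite (optimalBases G p)).image (sigmaMaxB G)
  ⟨(h.image _).csSup_mem hf, fun _ hx => le_csSup hf.bddAbove hx⟩

theorem sigmaLow_le_sigmaHigh {G : Matrix ρ ι ℝ} {p : ι → ℝ} (h : (optimalBases G p).Nonempty) :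
    sigmaLow G p ≤ sigmaHigh G p := by
  obtain ⟨B, hB⟩ := h
  calc sigmaLow G p ≤ sigmaMinB G B := (isLeast_sigmaLow ⟨B, hB⟩).2 ⟨B, hB, rfl⟩
    _ ≤ sigmaMaxB G B := LinearMap.singularValues_antitone _ (Nat.zero_le _)
    _ ≤ sigmaHigh G p := (isGreatest_sigmaHigh ⟨B, hB⟩).2 ⟨B, hB, rfl⟩

/-- The minimum is attained at a basis, whose matrix is injective. Without columns there is no
positive singular value, hence `Nonempty ι`. -/
theorem sigmaLow_pos [Nonempty ι] {G : Matrix ρ ι ℝ} {p : ι → ℝ}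
    (h : (optimalBases G p).Nonempty) : 0 < sigmaLow G p := by
  obtain ⟨B, ⟨d, -, hB, -⟩, he⟩ := (isLeast_sigmaLow h).1
  rw [← he]
  refine (LinearMap.injective_iff_forall_lt_finrank_singularValues_pos _).1 ?_ _ ?_
  · intro x y hxy
    rw [toLpLin_apply, toLpLin_apply] at hxy
    exact (WithLp.ofLp_injective 2) (hB.1 ((WithLp.toLp_injective 2) hxy))
  · rw [finrank_euclideanSpace]
    exact Nat.sub_lt Fintype.card_pos one_pos

theorem rate_nonneg {G : Matrix ρ ι ℝ} {p : ι → ℝ} (h : (optimalBases G p).Nonempty) :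
    0 ≤ rate G p :=
  div_nonneg (sub_nonneg.2 (pow_le_pow_left₀ (sigmaLow_nonneg G p) (sigmaLow_le_sigmaHigh h) 2))
    (by positivity)

theorem Gam_nonneg {G : Matrix ρ ι ℝ} {p : ι → ℝ} (h : (optimalBases G p).Nonempty) :
    0 ≤ Gam G p :=
  div_nonneg ((sigmaLow_nonneg G p).trans (sigmaLow_le_sigmaHigh h)) (by positivity)

end Constants

/-! ### Exponential decay of sensitivity for banded matrices -/

section Decay

variable {N : ℕ} {R V : Type*}

/-- The `i`-th stage as a linear function. -/
def stageL {ι : Type*} (i : Fin N) : (Fin N × ι → ℝ) →ₗ[ℝ] EuclideanSpace ℝ ι where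
  toFun y := stage y i
  map_add' _ _ := rfl
  map_smul' _ _ := rfl

theorem stageL_apply {ι : Type*} (i : Fin N) (y : Fin N × ι → ℝ) : stageL i y = stage y i := rfl

/-- The part of a stacked vector that belongs to stage `j`. -/
def atStage {ι : Type*} (j : Fin N) (e : Fin N × ι → ℝ) : Fin N × ι → ℝ :=
  fun r => if r.1 = j then e r else 0

theorem sum_atStage {ι : Type*} (e : Fin N × ι → ℝ) : ∑ j, atStage j e = e := by
  funext r
  simp [atStage]

theorem norm_sq_toLp_eq_sum_stage {ι : Type*} [Fintype ι] (y : Fin N × ι → ℝ) :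
    ‖WithLp.toLp 2 y‖ ^ 2 = ∑ i, ‖stage y i‖ ^ 2 := by
  simp only [EuclideanSpace.real_norm_sq_eq, stage, Fintype.sum_prod_type]

theorem norm_stage_le_norm {ι : Type*} [Fintype ι] (y : EuclideanSpace ℝ (Fin N × ι)) (i : Fin N) :
    ‖stage y.ofLp i‖ ≤ ‖y‖ := by
  refine le_of_sq_le_sq ?_ (norm_nonneg _)
  rw [← WithLp.toLp_ofLp 2 y, norm_sq_toLp_eq_sum_stage]
  exact Finset.single_le_sum (f := fun i => ‖stage y.ofLp i‖ ^ 2) (fun _ _ => sq_nonneg _)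
    (Finset.mem_univ i)

variable [Fintype R] [Fintype V] [DecidableEq V]

/-- Rows of a stage involve only the variables of this stage and of the previous one. -/
def IsBanded (G : Matrix (Fin N × R) (Fin N × V) ℝ) : Prop :=
  ∀ r c, r.1 ≠ c.1 → (r.1 : ℕ) ≠ (c.1 : ℕ) + 1 → G r c = 0

theorem adjoint_toEuclideanLin_apply (G : Matrix (Fin N × R) (Fin N × V) ℝ)
    (B : Finset (Fin N × R)) (y : EuclideanSpace ℝ B) (c : Fin N × V) :
    LinearMap.adjoint (toEuclideanLin (rowSub G B)) y c = ∑ b : B, G b c * y b := by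
  classical
  rw [← Matrix.toEuclideanLin_conjTranspose_eq_adjoint, toLpLin_apply]
  simp [mulVec, dotProduct, rowSub]

/-- Each step of the gradient iteration spreads the support by one stage. -/
theorem iterate_apply_eq_zero {G : Matrix (Fin N × R) (Fin N × V) ℝ} (hG : IsBanded G)
    (B : Finset (Fin N × R)) {e : EuclideanSpace ℝ B} {j : Fin N}
    (he : ∀ b : B, b.1.1 ≠ j → e b = 0) (α : ℝ) (m : ℕ) :
    ∀ c : Fin N × V, m < ((c.1 : ℤ) - (j : ℤ)).natAbs →
      (fun y => y + α • LinearMap.adjoint (toEuclideanLin (rowSub G B))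
        (e - toEuclideanLin (rowSub G B) y))^[m] 0 c = 0 := by
  induction m with
  | zero => simp
  | succ m ih =>
    intro c hc
    rw [Function.iterate_succ_apply']
    set y := (fun y => y + α • LinearMap.adjoint (toEuclideanLin (rowSub G B))
        (e - toEuclideanLin (rowSub G B) y))^[m] 0
    rw [PiLp.add_apply, PiLp.smul_apply, ih c (by omega), adjoint_toEuclideanLin_apply,
      Finset.sum_eq_zero, smul_zero, add_zero]
    rintro ⟨b, hb⟩ -
    -- A row that meets column `c` lies at the stage of `c` or the next, and its columns lie within
    -- one stage of `c`, where the old iterate still vanishes.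
    by_cases hbc : b.1 = c.1 ∨ (b.1 : ℕ) = (c.1 : ℕ) + 1
    · have hbc' : (b.1 : ℕ) = c.1 ∨ (b.1 : ℕ) = (c.1 : ℕ) + 1 :=
        hbc.imp_left fun h => congrArg Fin.val h
      have hej : e ⟨b, hb⟩ = 0 := he _ fun h => by
        have : (b.1 : ℕ) = j := congrArg Fin.val h
        omega
      have hT : toEuclideanLin (rowSub G B) y ⟨b, hb⟩ = 0 := by
        change ∑ k, G b k * y k = 0
        refine Finset.sum_eq_zero fun k _ => ?_
        by_cases hk : b.1 = k.1 ∨ (b.1 : ℕ) = (k.1 : ℕ) + 1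
        · have hk' : (b.1 : ℕ) = k.1 ∨ (b.1 : ℕ) = (k.1 : ℕ) + 1 :=
            hk.imp_left fun h => congrArg Fin.val h
          rw [ih k (by omega), mul_zero]
        · push Not at hk
          rw [hG b k hk.1 hk.2, zero_mul]
      rw [PiLp.sub_apply, hej, hT, sub_zero, mul_zero]
    · push Not at hbc
      change G b c * _ = 0
      rw [hG b c hbc.1 hbc.2, zero_mul]

theorem norm_restrict_le {e : Fin N × R → ℝ} {j : Fin N} (he : ∀ r, r.1 ≠ j → e r = 0)
    (B : Finset (Fin N × R)) :
    ‖(WithLp.toLp 2 (fun b : B => e b) : EuclideanSpace ℝ B)‖ ≤ ‖stage e j‖ := by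
  refine le_of_sq_le_sq ?_ (norm_nonneg _)
  rw [EuclideanSpace.real_norm_sq_eq, EuclideanSpace.real_norm_sq_eq]
  calc ∑ b : B, e b ^ 2 = ∑ b ∈ B, e b ^ 2 := Finset.sum_coe_sort B fun b => e b ^ 2
    _ ≤ ∑ r, e r ^ 2 :=
      Finset.sum_le_sum_of_subset_of_nonneg (Finset.subset_univ _) fun _ _ _ => sq_nonneg _
    _ = ∑ a, e (j, a) ^ 2 := by
      rw [Fintype.sum_prod_type, Finset.sum_eq_single j]
      · intro i _ hi
        exact Finset.sum_eq_zero fun a _ => by rw [he _ hi]; simp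
      · simp

/-- With `m = |i - j| - 1` gradient steps the iterate has not reached stage `i`, so `x` at stage `i`
is bounded by the iteration error. -/
theorem norm_stage_le_of_supported {G : Matrix (Fin N × R) (Fin N × V) ℝ} (hG : IsBanded G)
    {p : Fin N × V → ℝ} (hpos : 0 < sigmaLow G p) {B : Finset (Fin N × R)}
    (hB : B ∈ optimalBases G p) {e : Fin N × R → ℝ} {j : Fin N} (he : ∀ r, r.1 ≠ j → e r = 0)
    {x : Fin N × V → ℝ} (hx : IsBasicSolution G e B x) (i : Fin N) :
    ‖stage x i‖ ≤
      Gam G p * ‖stage e j‖ * rate G p ^ (((i : ℤ) - (j : ℤ)).natAbs - 1) := by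
  have hne : (optimalBases G p).Nonempty := ⟨B, hB⟩
  set a := sigmaLow G p with ha
  set b := sigmaHigh G p with hb
  have hab : a ≤ b := sigmaLow_le_sigmaHigh hne
  set T := toEuclideanLin (rowSub G B) with hT
  set m := ((i : ℤ) - (j : ℤ)).natAbs - 1 with hm
  have hmin : a ≤ T.singularValues (Module.finrank ℝ (EuclideanSpace ℝ (Fin N × V)) - 1) := by
    rw [finrank_euclideanSpace]
    exact (isLeast_sigmaLow hne).2 ⟨B, hB, rfl⟩
  have hmax : T.singularValues 0 ≤ b := (isGreatest_sigmaHigh hne).2 ⟨B, hB, rfl⟩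
  let X : EuclideanSpace ℝ (Fin N × V) := WithLp.toLp 2 x
  let Y : EuclideanSpace ℝ B := WithLp.toLp 2 (fun b : B => e b)
  have hTX : T X = Y := congrArg (WithLp.toLp 2) hx
  have herr := norm_sub_iterate_le T hpos hab hmin hmax hTX m
  set W := (fun y => y + (2 / (b ^ 2 + a ^ 2)) • LinearMap.adjoint T (Y - T y))^[m] 0 with hW
  have hzero : stage W.ofLp i = 0 := by
    ext v
    change W (i, v) = 0
    by_cases hij : ((i : ℤ) - (j : ℤ)).natAbs = 0
    -- For `i = j` the subtraction truncates to zero and the iterate is the starting point `0`.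
    · have h0 : m = 0 := by omega
      rw [hW, h0]
      simp
    · exact iterate_apply_eq_zero hG B (fun b hb => he _ hb) _ m (i, v) (by
        change m < ((i : ℤ) - (j : ℤ)).natAbs
        omega)
  have hstage : stage x i = stage (X - W).ofLp i := by
    change stageL i x = stageL i (x - W.ofLp)
    rw [map_sub, stageL_apply i W.ofLp, hzero, sub_zero]
  -- Inverting gives the factor `1 / a`, which `a ≤ b` weakens to `b / a²`, the constant `Gam`.
  have hX : ‖X‖ ≤ b / a ^ 2 * ‖stage e j‖ := by
    have h1 := mul_norm_le_norm_apply T hpos.le hmin X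
    rw [hTX] at h1
    have h2 : a * ‖X‖ ≤ ‖stage e j‖ := h1.trans (norm_restrict_le he B)
    rw [div_mul_eq_mul_div, le_div_iff₀ (by positivity)]
    calc ‖X‖ * a ^ 2 = a * (a * ‖X‖) := by ring
      _ ≤ a * ‖stage e j‖ := mul_le_mul_of_nonneg_left h2 hpos.le
      _ ≤ b * ‖stage e j‖ := mul_le_mul_of_nonneg_right hab (norm_nonneg _)
  calc ‖stage x i‖ ≤ ‖X - W‖ := by
        rw [hstage]
        exact norm_stage_le_norm _ i
    _ ≤ rate G p ^ m * ‖X‖ := herr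
    _ ≤ rate G p ^ m * (Gam G p * ‖stage e j‖) :=
        mul_le_mul_of_nonneg_left hX (pow_nonneg (rate_nonneg hne) _)
    _ = _ := mul_comm _ _

/-- Exponential decay of the sensitivity of basic solutions. -/
theorem norm_stage_basicSolution_le {G : Matrix (Fin N × R) (Fin N × V) ℝ} (hG : IsBanded G)
    {p : Fin N × V → ℝ} (hpos : 0 < sigmaLow G p) {B : Finset (Fin N × R)}
    (hB : B ∈ optimalBases G p) {e : Fin N × R → ℝ}
    {x : Fin N × V → ℝ} (hx : IsBasicSolution G e B x) (i : Fin N) :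
    ‖stage x i‖ ≤
      ∑ j, Gam G p * ‖stage e j‖ * rate G p ^ (((i : ℤ) - (j : ℤ)).natAbs - 1) := by
  obtain ⟨-, -, hbas, -⟩ := id hB
  have hsum : stage x i = ∑ j, stage (basicSolution hbas (atStage j e)) i := by
    change stageL i x = ∑ j, stageL i (basicSolution hbas (atStage j e))
    rw [← map_sum, ← map_sum, sum_atStage, ← hx.eq_basicSolution hbas]
  rw [hsum]
  refine (norm_sum_le _ _).trans (Finset.sum_le_sum fun j _ => ?_)
  have hj : stage (atStage j e) j = stage e j := by
    ext a
    simp [stage, atStage]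
  rw [← hj]
  exact norm_stage_le_of_supported hG hpos hB (fun r hr => if_neg hr)
    (isBasicSolution_basicSolution hbas _) i

end Decay

/-! ### Programs with box constraints -/

theorem isCompact_isFeasible_of_box {ρ ι : Type*} [Fintype ι] {G : Matrix ρ ι ℝ} {l u : ι → ρ}
    (hl : ∀ z i, (G *ᵥ z) (l i) = z i) (hu : ∀ z i, (G *ᵥ z) (u i) = -z i) (d : ρ → ℝ) :
    IsCompact {z | IsFeasible G d z} := by
  refine (isCompact_Icc (a := fun i => d (l i)) (b := fun i => -d (u i))).of_isClosed_subset
    (isClosed_isFeasible G d) fun z hz => ⟨fun i => ?_, fun i => ?_⟩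
  · exact (hz (l i)).trans_eq (hl z i)
  · have := (hz (u i)).trans_eq (hu z i)
    exact le_neg_of_le_neg this

variable {N K nx nu nw : ℕ}

/-- The row with the opposite coefficients. -/
def negRow : Row nx nu nw → Row nx nu nw
  | .inl a => .inr (.inl a)
  | .inr (.inl a) => .inl a
  | .inr (.inr (.inl a)) => .inr (.inr (.inr (.inl a)))
  | .inr (.inr (.inr (.inl a))) => .inr (.inr (.inl a))
  | .inr (.inr (.inr (.inr (.inl a)))) => .inr (.inr (.inr (.inr (.inr (.inl a)))))
  | .inr (.inr (.inr (.inr (.inr (.inl a))))) => .inr (.inr (.inr (.inr (.inl a))))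
  | .inr (.inr (.inr (.inr (.inr (.inr (.inl a)))))) =>
      .inr (.inr (.inr (.inr (.inr (.inr (.inr a))))))
  | .inr (.inr (.inr (.inr (.inr (.inr (.inr a)))))) =>
      .inr (.inr (.inr (.inr (.inr (.inr (.inl a))))))

/-- The row that bounds a variable from below. -/
def boxRow : Var nx nu → Row nx nu nw
  | .inl a => .inr (.inr (.inr (.inr (.inl a))))
  | .inr a => .inr (.inr (.inr (.inr (.inr (.inr (.inl a))))))

namespace MPCSystem

theorem Gdiag_negRow (S : MPCSystem N nx nu nw) (i : Fin N) (r : Row nx nu nw) (c : Var nx nu) :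
    S.Gdiag i (negRow r) c = -S.Gdiag i r c := by
  rcases r with a | a | a | a | a | a | a | a <;> rcases c with c | c <;> simp [Gdiag, negRow]

theorem Gsub_negRow (S : MPCSystem N nx nu nw) (i : Fin N) (r : Row nx nu nw) (c : Var nx nu) :
    S.Gsub i (negRow r) c = -S.Gsub i r c := by
  rcases r with a | a | a | a | a | a | a | a <;> rcases c with c | c <;> simp [Gsub, negRow]

theorem Gdiag_boxRow (S : MPCSystem N nx nu nw) (i : Fin N) (a c : Var nx nu) :
    S.Gdiag i (boxRow a) c = if a = c then 1 else 0 := by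
  rcases a with a | a <;> rcases c with c | c <;> simp [Gdiag, boxRow, Matrix.one_apply]

theorem Gsub_boxRow (S : MPCSystem N nx nu nw) (i : Fin N) (a c : Var nx nu) :
    S.Gsub i (boxRow a) c = 0 := by
  rcases a with a | a <;> rcases c with c | c <;> simp [Gsub, boxRow]

theorem isBanded (S : MPCSystem N nx nu nw) : IsBanded S.G := fun r c h1 h2 => by
  simp [G, h1, h2]

theorem G_mulVec_negRow (S : MPCSystem N nx nu nw) (z : Fin N × Var nx nu → ℝ) (i : Fin N)
    (r : Row nx nu nw) : (S.G *ᵥ z) (i, negRow r) = -(S.G *ᵥ z) (i, r) := by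
  simp only [mulVec, dotProduct, ← Finset.sum_neg_distrib]
  refine Finset.sum_congr rfl fun c _ => ?_
  simp only [G, Gdiag_negRow, Gsub_negRow]
  split_ifs <;> ring

theorem G_mulVec_boxRow (S : MPCSystem N nx nu nw) (z : Fin N × Var nx nu → ℝ) (i : Fin N)
    (a : Var nx nu) : (S.G *ᵥ z) (i, boxRow a) = z (i, a) := by
  simp only [mulVec, dotProduct]
  rw [Finset.sum_eq_single (i, a)]
  · simp [G, Gdiag_boxRow]
  · rintro ⟨j, c⟩ - hne
    simp only [G, Gdiag_boxRow, Gsub_boxRow]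
    by_cases hij : i = j
    · have hac : a ≠ c := fun h => hne (by rw [hij, h])
      simp [hac]
    · simp [hij]
  · simp

theorem isCompact_isFeasible (S : MPCSystem N nx nu nw) (d : Fin N × Row nx nu nw → ℝ) :
    IsCompact {z | IsFeasible S.G d z} :=
  isCompact_isFeasible_of_box (l := fun c => (c.1, boxRow c.2))
    (u := fun c => (c.1, negRow (boxRow c.2)))
    (fun z c => S.G_mulVec_boxRow z c.1 c.2)
    (fun z c => by rw [G_mulVec_negRow, G_mulVec_boxRow]) d

/-- Inequalities that hold for all rows of a stage hold with equality. -/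
theorem G_mulVec_eq_of_le (S : MPCSystem N nx nu nw) {y z : Fin N × Var nx nu → ℝ} {i : Fin N}
    (h : ∀ r, (S.G *ᵥ z) (i, r) ≤ (S.G *ᵥ y) (i, r)) (r : Row nx nu nw) :
    (S.G *ᵥ y) (i, r) = (S.G *ᵥ z) (i, r) := by
  have := h (negRow r)
  rw [G_mulVec_negRow, G_mulVec_negRow] at this
  exact le_antisymm (neg_le_neg_iff.1 this) (h r)

end MPCSystem

/-! ### Coarsening operators -/

namespace CoarseGrid

theorem mem_block {g : CoarseGrid N K} {k : Fin K} {i : Fin N} :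
    i ∈ g.block k ↔ g.M k.castSucc ≤ (i : ℕ) ∧ (i : ℕ) < g.M k.succ := by
  simp [block]

/-- If no block held `i`, induction would push every grid point, including the last one `N`, below
`i`. -/
theorem exists_mem_block (g : CoarseGrid N K) (i : Fin N) : ∃ k, i ∈ g.block k := by
  by_contra h
  push Not at h
  have key : ∀ k : Fin (K + 1), g.M k ≤ i := by
    intro k
    induction k using Fin.induction with
    | zero => rw [g.first]; exact Nat.zero_le _
    | succ k ih =>
      by_contra hlt
      exact h k (mem_block.2 ⟨ih, not_le.1 hlt⟩)
  have := key (Fin.last K)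
  rw [g.last] at this
  exact absurd i.2 (not_lt.2 this)

theorem eq_of_mem_block {g : CoarseGrid N K} {k l : Fin K} {i : Fin N} (hk : i ∈ g.block k)
    (hl : i ∈ g.block l) : k = l := by
  have key : ∀ {k l : Fin K}, i ∈ g.block k → i ∈ g.block l → ¬ k < l := by
    intro k l hk hl hlt
    have h1 := (mem_block.1 hk).2
    have h2 := (mem_block.1 hl).1
    have h3 : g.M k.succ ≤ g.M l.castSucc := g.strictMono.monotone (by
      rw [Fin.le_def]
      simpa using hlt)
    omega
  exact le_antisymm (not_lt.1 (key hl hk)) (not_lt.1 (key hk hl))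

theorem card_block_pos (g : CoarseGrid N K) (k : Fin K) : 0 < (g.block k).card := by
  have h1 : g.M k.castSucc < g.M k.succ := g.strictMono Fin.castSucc_lt_succ
  have h2 : g.M k.succ ≤ N :=
    (g.strictMono.monotone (Fin.le_last _)).trans_eq g.last
  exact Finset.card_pos.2 ⟨⟨g.M k.castSucc, by omega⟩, mem_block.2 ⟨le_rfl, h1⟩⟩

variable {ι : Type*} [Fintype ι] [DecidableEq ι]

theorem op_mulVec (g : CoarseGrid N K) (w : Fin K × ι → ℝ) {i : Fin N} {k : Fin K}
    (hi : i ∈ g.block k) (a : ι) :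
    (g.op ι *ᵥ w) (i, a) = (√((g.block k).card : ℝ))⁻¹ * w (k, a) := by
  simp only [mulVec, dotProduct]
  rw [Finset.sum_eq_single (k, a)]
  · simp [op, hi]
  · rintro ⟨l, b⟩ - hne
    have : ¬ (i ∈ g.block l ∧ a = b) := fun ⟨hl, hb⟩ => hne (by rw [eq_of_mem_block hl hi, hb])
    simp [op, this]
  · simp

theorem op_transpose_mulVec (g : CoarseGrid N K) (y : Fin N × ι → ℝ) (k : Fin K) (a : ι) :
    ((g.op ι)ᵀ *ᵥ y) (k, a) = (√((g.block k).card : ℝ))⁻¹ * ∑ i ∈ g.block k, y (i, a) := by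
  simp only [mulVec, dotProduct, transpose_apply, Fintype.sum_prod_type, op]
  rw [Finset.mul_sum, ← Finset.sum_filter_add_sum_filter_not Finset.univ (· ∈ g.block k)]
  rw [Finset.sum_eq_zero (s := Finset.univ.filter fun i => ¬ i ∈ g.block k), add_zero]
  · rw [Finset.filter_mem_eq_inter, Finset.univ_inter]
    refine Finset.sum_congr rfl fun i hi => ?_
    rw [Finset.sum_eq_single a]
    · simp [hi]
    · intro b _ hb
      simp [hb]
    · simp
  · intro i hi
    refine Finset.sum_eq_zero fun b _ => ?_
    simp [(Finset.mem_filter.1 hi).2]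

end CoarseGrid

/-! ### The coarse program and its comparison with the full one -/

section Coarse

variable (S : MPCSystem N nx nu nw) (g : CoarseGrid N K)

theorem coarseG_mulVec (zt : Fin K × Var nx nu → ℝ) :
    coarseG S g *ᵥ zt = (g.U nx nu nw)ᵀ *ᵥ (S.G *ᵥ (g.T nx nu *ᵥ zt)) := by
  simp [coarseG, mulVec_mulVec, Matrix.mul_assoc]

theorem coarseG_mulVec_negRow (zt : Fin K × Var nx nu → ℝ) (k : Fin K) (r : Row nx nu nw) :
    (coarseG S g *ᵥ zt) (k, negRow r) = -(coarseG S g *ᵥ zt) (k, r) := by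
  rw [coarseG_mulVec, CoarseGrid.U, CoarseGrid.op_transpose_mulVec, CoarseGrid.op_transpose_mulVec]
  simp [MPCSystem.G_mulVec_negRow]

/-- The factors `L_k^{-1/2}` from `U` and `T` cancel the `L_k` equal terms of the block, so box rows
survive coarsening and the coarse feasible set is compact. -/
theorem coarseG_mulVec_boxRow (zt : Fin K × Var nx nu → ℝ) (k : Fin K) (a : Var nx nu) :
    (coarseG S g *ᵥ zt) (k, boxRow a) = zt (k, a) := by
  rw [coarseG_mulVec, CoarseGrid.U, CoarseGrid.op_transpose_mulVec]
  have hpos : (0 : ℝ) < (g.block k).card := by exact_mod_cast g.card_block_pos k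
  have hi : ∀ i ∈ g.block k, (S.G *ᵥ (g.T nx nu *ᵥ zt)) (i, boxRow a) =
      (√((g.block k).card : ℝ))⁻¹ * zt (k, a) := fun i hi =>
    (S.G_mulVec_boxRow _ i a).trans (g.op_mulVec zt hi a)
  rw [Finset.sum_congr rfl hi, Finset.sum_const, nsmul_eq_mul]
  have h1 := Real.mul_self_sqrt hpos.le
  have h2 := (Real.sqrt_pos.2 hpos).ne'
  field_simp
  rw [sq, h1]

theorem isCompact_isFeasible_coarse (dt : Fin K × Row nx nu nw → ℝ) :
    IsCompact {zt | IsFeasible (coarseG S g) dt zt} :=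
  isCompact_isFeasible_of_box (l := fun c => (c.1, boxRow c.2))
    (u := fun c => (c.1, negRow (boxRow c.2)))
    (fun z c => coarseG_mulVec_boxRow S g z c.1 c.2)
    (fun z c => by rw [coarseG_mulVec_negRow, coarseG_mulVec_boxRow]) dt

/-- Feasibility for the coarse program means that the constraints hold on average over blocks. -/
theorem isFeasible_coarse_iff {d : Fin N × Row nx nu nw → ℝ} {zo : Fin N × Var nx nu → ℝ}
    {zt : Fin K × Var nx nu → ℝ} :
    IsFeasible (coarseG S g) (coarseD S g d zo) zt ↔
      ∀ k r, ∑ i ∈ g.block k, d (i, r) ≤ ∑ i ∈ g.block k, (S.G *ᵥ project g zo zt) (i, r) := by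
  rw [IsFeasible, Prod.forall]
  refine forall_congr' fun k => forall_congr' fun r => ?_
  have hpos : (0 : ℝ) < (g.block k).card := by exact_mod_cast g.card_block_pos k
  rw [coarseG_mulVec, coarseD, CoarseGrid.U, CoarseGrid.op_transpose_mulVec,
    CoarseGrid.op_transpose_mulVec, mul_le_mul_iff_right₀ (inv_pos.2 (Real.sqrt_pos.2 hpos))]
  simp only [project, mulVec_add, Pi.add_apply, Pi.sub_apply, Finset.sum_sub_distrib,
    Finset.sum_add_distrib]
  constructor <;> intro h <;> linarith

theorem coarseP_dotProduct (p : Fin N × Var nx nu → ℝ) (lo : Fin N × Row nx nu nw → ℝ)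
    (zt : Fin K × Var nx nu → ℝ) :
    coarseP S g p lo ⬝ᵥ zt =
      p ⬝ᵥ (g.T nx nu *ᵥ zt) - lo ⬝ᵥ (S.G *ᵥ (g.T nx nu *ᵥ zt)) := by
  rw [coarseP, mulVec_transpose, ← dotProduct_mulVec, sub_dotProduct, mulVec_transpose,
    ← dotProduct_mulVec]

theorem zero_isFeasible_coarse {d : Fin N × Row nx nu nw → ℝ} {zo : Fin N × Var nx nu → ℝ}
    (hzo : IsFeasible S.G d zo) : IsFeasible (coarseG S g) (coarseD S g d zo) 0 := by
  rw [isFeasible_coarse_iff]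
  intro k r
  refine Finset.sum_le_sum fun i _ => ?_
  simpa [project] using hzo (i, r)

theorem mem_freeStages {lo : Fin N × Row nx nu nw → ℝ} {i : Fin N} :
    i ∈ freeStages g lo ↔ ∃ k ∈ freeBlocks g lo, i ∈ g.block k := by
  simp [freeStages]

theorem block_eq_singleton_of_free {lo : Fin N × Row nx nu nw → ℝ} {i : Fin N} {k : Fin K}
    (hk : k ∈ freeBlocks g lo) (hi : i ∈ g.block k) : g.block k = {i} := by
  obtain ⟨-, h1, -⟩ := Finset.mem_filter.1 hk
  obtain ⟨j, hj⟩ := Finset.card_eq_one.1 h1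
  rw [hj, Finset.mem_singleton] at hi
  rw [hj, hi]

/-- A vector that agrees with a projected one outside of the free stages is projected. -/
theorem exists_eq_project {lo : Fin N × Row nx nu nw → ℝ} {zo y : Fin N × Var nx nu → ℝ}
    {zt : Fin K × Var nx nu → ℝ}
    (h : ∀ i ∉ freeStages g lo, ∀ a, y (i, a) = project g zo zt (i, a)) :
    ∃ yt, y = project g zo yt := by
  classical
  -- A free block has one stage and scaling factor `1`, so any deviation from `zo` there is its own
  -- coarse coordinate.
  refine ⟨fun c => if c.1 ∈ freeBlocks g lo then ∑ i ∈ g.block c.1, (y (i, c.2) - zo (i, c.2))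
    else zt c, ?_⟩
  funext ⟨i, a⟩
  obtain ⟨k, hk⟩ := g.exists_mem_block i
  simp only [project, Pi.add_apply]
  rw [CoarseGrid.T, g.op_mulVec _ hk]
  by_cases hf : k ∈ freeBlocks g lo
  · simp [hf, block_eq_singleton_of_free g hf hk]
  · rw [h i (fun hi => ?_) a]
    · simp only [project, Pi.add_apply, hf, if_false]
      rw [CoarseGrid.T, g.op_mulVec _ hk]
    · obtain ⟨l, hl, hil⟩ := (mem_freeStages g).1 hi
      rw [CoarseGrid.eq_of_mem_block hil hk] at hl
      exact hf hl

/-- The data for which a projected vector is feasible and determined outside of the free stages. -/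
def shiftedData (d : Fin N × Row nx nu nw → ℝ) (lo : Fin N × Row nx nu nw → ℝ)
    (z : Fin N × Var nx nu → ℝ) : Fin N × Row nx nu nw → ℝ :=
  fun r => if r.1 ∈ freeStages g lo then d r else (S.G *ᵥ z) r

variable {S g}

/-- On a free stage the block average is the original constraint; elsewhere the data are attained
with equality. -/
theorem isFeasible_shiftedData {d : Fin N × Row nx nu nw → ℝ} {lo : Fin N × Row nx nu nw → ℝ}
    {zo : Fin N × Var nx nu → ℝ} {zt : Fin K × Var nx nu → ℝ}
    (h : IsFeasible (coarseG S g) (coarseD S g d zo) zt) :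
    IsFeasible S.G (shiftedData S g d lo (project g zo zt)) (project g zo zt) := by
  rintro ⟨i, r⟩
  unfold shiftedData
  split_ifs with hi
  · obtain ⟨k, hk, hik⟩ := (mem_freeStages g).1 hi
    simpa [block_eq_singleton_of_free g hk hik] using (isFeasible_coarse_iff S g).1 h k r
  · exact le_rfl

/-- Solutions for the shifted data are projected coarse solutions. -/
theorem isProjectedCoarseSolution_of_shiftedData {d : Fin N × Row nx nu nw → ℝ}
    {p : Fin N × Var nx nu → ℝ} {lo : Fin N × Row nx nu nw → ℝ} {zo : Fin N × Var nx nu → ℝ}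
    {zt : Fin K × Var nx nu → ℝ}
    (h : IsSolution (coarseG S g) (coarseD S g d zo) (coarseP S g p lo) zt)
    {y : Fin N × Var nx nu → ℝ}
    (hy : IsSolution S.G (shiftedData S g d lo (project g zo zt)) p y) :
    IsProjectedCoarseSolution S g d p zo lo y := by
  have hGy : ∀ i ∉ freeStages g lo, ∀ r,
      (S.G *ᵥ y) (i, r) = (S.G *ᵥ project g zo zt) (i, r) := fun i hi =>
    S.G_mulVec_eq_of_le fun r => by simpa [shiftedData, hi] using hy.1 (i, r)
  obtain ⟨yt, rfl⟩ := exists_eq_project (lo := lo) (zo := zo) (y := y) (zt := zt) g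
    fun i hi a => by
      rw [← S.G_mulVec_boxRow y, hGy i hi, S.G_mulVec_boxRow]
  have hfeas : IsFeasible (coarseG S g) (coarseD S g d zo) yt := by
    rw [isFeasible_coarse_iff]
    intro k r
    by_cases hk : k ∈ freeBlocks g lo
    · refine Finset.sum_le_sum fun i hi => ?_
      have hfree : i ∈ freeStages g lo := (mem_freeStages g).2 ⟨k, hk, hi⟩
      simpa [shiftedData, hfree] using hy.1 (i, r)
    · refine ((isFeasible_coarse_iff S g).1 h.1 k r).trans_eq
        (Finset.sum_congr rfl fun i hi => (hGy i (fun hfree => hk ?_) r).symm)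
      obtain ⟨l, hl, hil⟩ := (mem_freeStages g).1 hfree
      rwa [CoarseGrid.eq_of_mem_block hil hi] at hl
  -- The dual term of the coarse cost is the same for both vectors: `lo` vanishes on free stages and
  -- `G y` is unchanged elsewhere.
  have hlo : lo ⬝ᵥ (S.G *ᵥ project g zo yt) = lo ⬝ᵥ (S.G *ᵥ project g zo zt) := by
    refine Finset.sum_congr rfl fun ⟨i, r⟩ _ => ?_
    by_cases hi : i ∈ freeStages g lo
    · obtain ⟨k, hk, hik⟩ := (mem_freeStages g).1 hi
      rw [(Finset.mem_filter.1 hk).2.2 i hik r, zero_mul, zero_mul]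
    · rw [hGy i hi]
  have hp : p ⬝ᵥ project g zo yt ≤ p ⬝ᵥ project g zo zt :=
    hy.2 _ (isFeasible_shiftedData h.1)
  refine ⟨yt, ⟨hfeas, fun wt hwt => le_trans ?_ (h.2 wt hwt)⟩, rfl⟩
  rw [coarseP_dotProduct, coarseP_dotProduct]
  simp only [project, mulVec_add, dotProduct_add] at hp hlo
  linarith

/-- The residual norms form a finite union of continuous images of the compact coarse feasible set;
it is nonempty because `zo` is the projection of the feasible point `0`. -/
theorem isGreatest_maxResidual (hN : 0 < N) {d : Fin N × Row nx nu nw → ℝ}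
    {zo : Fin N × Var nx nu → ℝ} (hzo : IsFeasible S.G d zo) :
    IsGreatest (residualNorms S g d zo) (maxResidual S g d zo) := by
  have heq : residualNorms S g d zo = ⋃ j, (fun zt => ‖stage (d - S.G *ᵥ project g zo zt) j‖) ''
      {zt | IsFeasible (coarseG S g) (coarseD S g d zo) zt} := by
    ext t
    simp only [residualNorms, Set.mem_iUnion, Set.mem_image, Set.mem_ofPred_eq]
    constructor
    · rintro ⟨zt, hzt, j, rfl⟩
      exact ⟨j, zt, hzt, rfl⟩
    · rintro ⟨j, zt, hzt, rfl⟩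
      exact ⟨zt, hzt, j, rfl⟩
  have hcomp : IsCompact (residualNorms S g d zo) := by
    rw [heq]
    refine isCompact_iUnion fun j => (isCompact_isFeasible_coarse S g _).image ?_
    have hcont : Continuous fun zt => d - S.G *ᵥ project g zo zt :=
      continuous_const.sub (continuous_const.matrix_mulVec
        (continuous_const.add (continuous_const.matrix_mulVec continuous_id)))
    exact (((stageL j).continuous_of_finiteDimensional).comp hcont).norm
  exact hcomp.isGreatest_sSup ⟨_, 0, zero_isFeasible_coarse S g hzo, ⟨0, hN⟩, rfl⟩

theorem norm_stage_shiftedData_sub_le {d : Fin N × Row nx nu nw → ℝ}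
    (lo : Fin N × Row nx nu nw → ℝ) {zo : Fin N × Var nx nu → ℝ} {zt : Fin K × Var nx nu → ℝ}
    {Δ : ℝ} (hΔ : Δ ∈ upperBounds (residualNorms S g d zo))
    (h : IsFeasible (coarseG S g) (coarseD S g d zo) zt) (j : Fin N) :
    ‖stage (d - shiftedData S g d lo (project g zo zt)) j‖ ≤
      if j ∈ freeStages g lo then 0 else Δ := by
  split_ifs with hj
  · refine (norm_eq_zero.2 ?_).le
    ext r
    simp [stage, shiftedData, hj]
  · refine le_of_eq_of_le (congrArg _ ?_) (hΔ ⟨zt, h, j, rfl⟩)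
    ext r
    simp [stage, shiftedData, hj]

end Coarse

end CoarseMPC

end

/-- The first three conjuncts say that the extrema defining the constants are attained. In the
exponent, `|i - j| - 1` is a truncated difference of natural numbers, i.e. `(|i - j| - 1)₊`. -/
theorem theorem4 {N K nx nu nw : ℕ} (hN : 0 < N)
    (S : CoarseMPC.MPCSystem N nx nu nw)
    (p : Fin N × CoarseMPC.Var nx nu → ℝ)
    (d : Fin N × CoarseMPC.Row nx nu nw → ℝ)
    (hd : d ∈ CoarseMPC.admissible S.G)
    (g : CoarseMPC.CoarseGrid N K)
    (zo : Fin N × CoarseMPC.Var nx nu → ℝ)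
    (lo : Fin N × CoarseMPC.Row nx nu nw → ℝ)
    (hzo : CoarseMPC.IsFeasible S.G d zo) :
    IsLeast (CoarseMPC.sigmaMinB S.G '' CoarseMPC.optimalBases S.G p)
      (CoarseMPC.sigmaLow S.G p) ∧
    IsGreatest (CoarseMPC.sigmaMaxB S.G '' CoarseMPC.optimalBases S.G p)
      (CoarseMPC.sigmaHigh S.G p) ∧
    IsGreatest (CoarseMPC.residualNorms S g d zo) (CoarseMPC.maxResidual S g d zo) ∧
    ∃ zs z' : Fin N × CoarseMPC.Var nx nu → ℝ,
      CoarseMPC.IsSolution S.G d p zs ∧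
      CoarseMPC.IsProjectedCoarseSolution S g d p zo lo z' ∧
      ∀ i : Fin N,
        ‖CoarseMPC.stage zs i - CoarseMPC.stage z' i‖ ≤
          ∑ j ∈ (CoarseMPC.freeStages g lo)ᶜ,
            CoarseMPC.Gam S.G p * CoarseMPC.maxResidual S g d zo *
              CoarseMPC.rate S.G p ^ (((i : ℤ) - (j : ℤ)).natAbs - 1) := by
  classical
  have hcomp := S.isCompact_isFeasible
  have hne := CoarseMPC.nonempty_optimalBases (hcomp d) hd p
  have hres := CoarseMPC.isGreatest_maxResidual (g := g) hN hzo
  refine ⟨CoarseMPC.isLeast_sigmaLow hne, CoarseMPC.isGreatest_sigmaHigh hne, hres, ?_⟩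
  obtain ⟨zt, hzt⟩ := CoarseMPC.exists_isSolution
    (CoarseMPC.isCompact_isFeasible_coarse S g (CoarseMPC.coarseD S g d zo))
    ⟨0, CoarseMPC.zero_isFeasible_coarse S g hzo⟩ (CoarseMPC.coarseP S g p lo)
  -- The path runs from the shifted data to `d`. Its starting solution serves as `z'`; it need not
  -- be the projection of `zt`.
  obtain ⟨z', zs, hz', hzs, hbound⟩ := CoarseMPC.exists_isSolution_norm_sub_le p hcomp
    ⟨_, CoarseMPC.isFeasible_shiftedData (lo := lo) hzt.1⟩ hd
  refine ⟨zs, z', hzs, CoarseMPC.isProjectedCoarseSolution_of_shiftedData hzt hz', fun i => ?_⟩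
  have hGam := CoarseMPC.Gam_nonneg hne
  have hrate := CoarseMPC.rate_nonneg hne
  have hΔ : 0 ≤ CoarseMPC.maxResidual S g d zo := by
    obtain ⟨_, -, _, h⟩ := hres.1
    exact h ▸ norm_nonneg _
  -- Without variables `sigmaLow` need not be positive, but both stage vectors are trivial.
  rcases isEmpty_or_nonempty (CoarseMPC.Var nx nu) with hV | hV
  · rw [norm_eq_zero.2 (Subsingleton.elim _ _)]
    exact Finset.sum_nonneg fun j _ => mul_nonneg (mul_nonneg hGam hΔ) (pow_nonneg hrate _)
  · have : Nonempty (Fin N × CoarseMPC.Var nx nu) := ⟨⟨⟨0, hN⟩, hV.some⟩⟩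
    refine hbound (CoarseMPC.stageL i) _ fun B hB x hx =>
      (CoarseMPC.norm_stage_basicSolution_le S.isBanded (CoarseMPC.sigmaLow_pos hne)
        hB hx i).trans ?_
    rw [Finset.compl_eq_univ_sdiff, ← Finset.filter_notMem_eq_sdiff, Finset.sum_filter]
    refine Finset.sum_le_sum fun j _ => ?_
    have hj := CoarseMPC.norm_stage_shiftedData_sub_le lo hres.2 hzt.1 j
    split_ifs at hj ⊢ with h
    · rw [le_antisymm hj (norm_nonneg _)]
      simp
    · exact mul_le_mul_of_nonneg_right (mul_le_mul_of_nonneg_left hj hGam) (pow_nonneg hrate _)
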